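/- **Model.** Let $[n]=\{1,\dots,n\}$. An input is an undirected simple graph $G=(V,E)$ with $V=[n]$ and maximum degree at most $d$, given by adjacency lists (in arbitrary order), together with a bijective labeling $\mathrm{num}:V\to[n]$. A (randomized, adaptive) algorithm that knows $n$, $d$ and $\varepsilon$ accesses the input only by *neighbor queries* (given $v\in V$ and $1\le i\le d$, return the $i$th neighbor of $v$, or a special symbol if $v$ has fewer than $i$ neighbors) and *label queries* (given $v\in V$, return $\mathrm{num}(v)$). The labeling $\mathrm{num}$ is a *valid DFS numbering* of $G$ if it is the order of discovery of the vertices in some run of depth-first search on $G$, where both the outer loop over all vertices and the loops over the neighbors of a vertex may be processed in arbitrary order. The labeled graph is *$\varepsilon$-far* from having a valid DFS numbering if $|E\,\triangle\,E'|>\varepsilon n$ for every graph $G'=(V,E')$ of maximum degree at most $d$ for which $\mathrm{num}$ is a valid DFS numbering. **Theorem.** For every $d$ there is a constant $C_d$, depending only on $d$, such that for all $0<\varepsilon<1$ and all $n$ there is a randomized query algorithm which, on every labeled graph $(G,\mathrm{num})$ with $n$ vertices and maximum degree at most $d$, 1. always performs at most $C_d\, n^{1/3}/\varepsilon$ queries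 (neighbor and label queries together), 2. always accepts if $\mathrm{num}$ is a valid DFS numbering of $G$, and 3. rejects with probability at least $2/3$ if $(G,\mathrm{num})$ is $\varepsilon$-far from having a valid DFS numbering. -/

import Mathlib

/-- The nested for-loops of depth-first search. `DFSLoop G us s s'` says: if `s` is the list of all
vertices discovered so far, in the order of their discovery, then some execution of
"for `u` in `us` (in this order): if `u` is undiscovered, then dfs-visit(`u`)" ends with the list
`s'` of discovered vertices. A call dfs-visit(`u`) discovers `u` (so that `u` receives the next free
number) and then runs the loop over the neighbors of `u`, listed in an arbitrary order `ws`. -/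
inductive DFSLoop {V : Type} (G : SimpleGraph V) : List V → List V → List V → Prop
  | nil (s : List V) : DFSLoop G [] s s
  | skip {u : V} {us s s' : List V} (discovered : u ∈ s) (rest : DFSLoop G us s s') :
      DFSLoop G (u :: us) s s'
  | visit {u : V} {us s s₁ s₂ : List V} (ws : List V) (undiscovered : u ∉ s)
      (ws_nodup : ws.Nodup) (mem_ws : ∀ w, w ∈ ws ↔ G.Adj u w)
      (call : DFSLoop G ws (s ++ [u]) s₁) (rest : DFSLoop G us s₁ s₂) :
      DFSLoop G (u :: us) s s₂

/-- `num` is a DFS numbering of `G`: for some order of the vertices in the outer loop, and some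
orders of the neighbors in the inner loops, DFS discovers the vertices in the order of their labels.
The set `[n]`, of vertices and of labels, is `Fin n` (so numbers are counted from `0`). -/
def IsDFSNumbering {n : ℕ} (G : SimpleGraph (Fin n)) (num : Fin n ≃ Fin n) : Prop :=
  ∃ order s : List (Fin n), order.Nodup ∧ (∀ v, v ∈ order) ∧
    DFSLoop G order [] s ∧ s.map num = List.finRange n

/-- An input of the bounded-degree model for labeled graphs: an undirected graph on `[n]` with
maximum degree at most `d`, represented by adjacency lists in an arbitrary order,
and a bijective labeling `num`. -/
structure LabeledGraph (n d : ℕ) where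
  graph : SimpleGraph (Fin n)
  adjList : Fin n → List (Fin n)
  adjList_nodup : ∀ v, (adjList v).Nodup
  mem_adjList : ∀ v u, u ∈ adjList v ↔ graph.Adj v u
  adjList_length : ∀ v, (adjList v).length ≤ d
  num : Fin n ≃ Fin n

/-- More than `ε * n` edges have to be inserted or deleted to turn the graph into a graph of
maximum degree at most `d` for which the given labeling is a DFS numbering. -/
def LabeledGraph.IsFar {n d : ℕ} (X : LabeledGraph n d) (ε : ℝ) : Prop :=
  ∀ G' : SimpleGraph (Fin n), (∀ v, (G'.neighborSet v).ncard ≤ d) → IsDFSNumbering G' X.num →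
    ε * n < ((symmDiff X.graph.edgeSet G'.edgeSet).ncard : ℝ)

/-- A deterministic adaptive algorithm with oracle access to a labeled graph. It either halts
(`true` is accept, `false` is reject), or asks for the `i`th neighbor of a vertex (the answer is
`none` if the vertex has fewer neighbors), or asks for the label of a vertex. -/
inductive QueryAlgorithm (n d : ℕ) : Type
  | halt (accept : Bool) : QueryAlgorithm n d
  | neighborQuery (v : Fin n) (i : Fin d) (next : Option (Fin n) → QueryAlgorithm n d) :
      QueryAlgorithm n d
  | labelQuery (v : Fin n) (next : Fin n → QueryAlgorithm n d) : QueryAlgorithm n d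

/-- The verdict on the input `X`. -/
def QueryAlgorithm.run {n d : ℕ} (X : LabeledGraph n d) : QueryAlgorithm n d → Bool
  | .halt b => b
  | .neighborQuery v i next => (next (X.adjList v)[(i : ℕ)]?).run X
  | .labelQuery v next => (next (X.num v)).run X

/-- The number of queries (of both types) performed on the input `X`. -/
def QueryAlgorithm.queries {n d : ℕ} (X : LabeledGraph n d) : QueryAlgorithm n d → ℕ
  | .halt _ => 0
  | .neighborQuery v i next => (next (X.adjList v)[(i : ℕ)]?).queries X + 1
  | .labelQuery v next => (next (X.num v)).queries X + 1

/-- A randomized algorithm draws its random choices, which are independent of the input,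
and then follows the resulting deterministic algorithm. -/
abbrev RandomizedTester (n d : ℕ) : Type := PMF (QueryAlgorithm n d)

/-- The probability that the input `X` is rejected. -/
noncomputable def RandomizedTester.rejectProb {n d : ℕ} (T : RandomizedTester n d)
    (X : LabeledGraph n d) : ENNReal :=
  T.toOuterMeasure {A | A.run X = false}

/-! Identify vertices with their labels. A labeling is a DFS numbering exactly when there is no
triple `a < b < c` with an edge `a c` such that all smaller neighbors of `b` lie below `a`
(`isDFSNumbering_iff`). Moreover, if a set `Z` of vertices hits all such violations, then O(d²|Z|)
edge modifications that respect the degree bound remove them (`exists_repair`). Hence in a graph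
that is ε-far every hitting set has size Ω(εn/d²) (`IsFar.lt_card`).

The tester combines two tests. The first starts at O(1/ε) random vertices and walks downwards
through the labels, one by one, for `k` ≈ n^(1/3) steps, running DFS in reverse; it rejects if the
search for a preceding label fails or if the visited neighborhoods contain a violation. On a valid
numbering this never happens (`isSome_walk`). Finding one predecessor may take a long descent, but
the descents for different vertices are disjoint (`disjoint_searchPath`). So the total cost over all
labels, the `fuel`, is at most 2n, and cutting the fuel scale into intervals of length `k` gives
O(n/k) blocks. The second test draws two samples of Θ(√(n/k)/ε) vertices and looks for a violation
in their neighborhoods.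

If Ω(εn) vertices fail the walk, then the first test rejects. Otherwise remove the failing vertices
and take a maximal matching of pairs (lower end, middle vertex) of the remaining violations; it has
Ω(εn) pairs. If two pairs `(a, x)`, `(a', x')` have `x ≤ x'` in the same block, then the passed
walks force `a` and `x'` to form a violation as well (`violates_of_block_eq`). This turns each block
into a dense relation between lower ends and middle vertices, and a second moment bound shows that
the two samples hit it (`card_hit_matching_ge`). The choice `k` ≈ n^(1/3) balances `k` against
√(n/k). Dependence on d is absorbed in the constants. -/

/-- The edge `a c` jumps over `b`, although `b` has no earlier neighbor at or after `a`. -/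
def Violates {n : ℕ} (L : SimpleGraph (Fin n)) (a b c : Fin n) : Prop :=
  a < b ∧ b < c ∧ L.Adj a c ∧ ∀ e, L.Adj e b → e < b → e < a

/-! ### Runs of depth-first search produce no violations. -/

theorem DFSLoop.map {V W : Type} {G : SimpleGraph V} {H : SimpleGraph W} (e : V ≃ W)
    (he : ∀ u v, H.Adj (e u) (e v) ↔ G.Adj u v) {us s s' : List V} (h : DFSLoop G us s s') :
    DFSLoop H (us.map e) (s.map e) (s'.map e) := by
  induction h with
  | nil s => exact .nil _
  | skip hd _ ih => exact .skip (List.mem_map_of_mem hd) ih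
  | @visit u us s s₁ s₂ ws hu hn hm _ _ ih1 ih2 =>
    refine .visit (ws.map e) ?_ (hn.map e.injective) ?_ ?_ ih2
    · simpa using hu
    · intro w
      obtain ⟨w, rfl⟩ := e.surjective w
      rw [he, ← hm]
      simp
    · simpa using ih1

theorem DFSLoop.isPrefix {V : Type} {G : SimpleGraph V} {us s s' : List V}
    (h : DFSLoop G us s s') : s <+: s' := by
  induction h with
  | nil s => exact List.prefix_rfl
  | skip _ _ ih => exact ih
  | visit ws hu hn hm _ _ ih1 ih2 => exact ((List.prefix_append _ _).trans ih1).trans ih2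

theorem DFSLoop.subset {V : Type} {G : SimpleGraph V} {us s s' : List V}
    (h : DFSLoop G us s s') : ∀ u ∈ us, u ∈ s' := by
  induction h with
  | nil s => simp
  | skip hd hr ih =>
    intro u hu
    rcases List.mem_cons.1 hu with rfl | hu
    · exact hr.isPrefix.subset hd
    · exact ih u hu
  | visit ws hu hn hm hc hr ih1 ih2 =>
    intro v hv
    rcases List.mem_cons.1 hv with rfl | hv
    · exact hr.isPrefix.subset (hc.isPrefix.subset (by simp))
    · exact ih2 v hv

theorem List.IsPrefix.getElem?_eq_some {α : Type} {s t : List α} (h : s <+: t) {i : ℕ} {a : α}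
    (hi : s[i]? = some a) : t[i]? = some a := by
  obtain ⟨r, rfl⟩ := h
  rw [List.getElem?_append_left (List.getElem?_eq_some_iff.1 hi).1, hi]

theorem List.IsPrefix.getElem?_of_lt {α : Type} {s t : List α} (h : s <+: t) {i : ℕ} {a : α}
    (hi : t[i]? = some a) (hl : i < s.length) : s[i]? = some a := by
  obtain ⟨r, rfl⟩ := h
  rwa [List.getElem?_append_left hl] at hi

/-- All neighbors of the vertices discovered during the loop are discovered at its end. -/
theorem DFSLoop.closed {V : Type} {G : SimpleGraph V} {us s s' : List V}
    (h : DFSLoop G us s s') : ∀ i a c, s.length ≤ i → s'[i]? = some a → G.Adj a c → c ∈ s' := by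
  induction h with
  | nil s =>
    intro i a c hi ha
    rw [List.getElem?_eq_none hi] at ha
    cases ha
  | skip _ _ ih => exact ih
  | @visit u us s s₁ s₂ ws hu hn hm hc hr ih1 ih2 =>
    intro i a c hi ha hac
    rcases le_or_gt s₁.length i with h1 | h1
    · exact ih2 i a c h1 ha hac
    · have ha1 := hr.isPrefix.getElem?_of_lt ha h1
      refine hr.isPrefix.subset ?_
      rcases hi.eq_or_lt with h0 | h0
      · have h2 : s₁[i]? = some u := hc.isPrefix.getElem?_eq_some (by simp [← h0])
        obtain rfl : a = u := by simpa [ha1] using h2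
        exact hc.subset c ((hm c).2 hac)
      · exact ih1 i a c (by simpa using h0) ha1 hac

/-- A vertex discovered during the loop belongs to the list or is adjacent to a vertex that was
discovered earlier in the loop. -/
theorem DFSLoop.exists_adj {V : Type} {G : SimpleGraph V} {us s s' : List V}
    (h : DFSLoop G us s s') : ∀ j b, s.length ≤ j → s'[j]? = some b →
      b ∈ us ∨ ∃ k e, s.length ≤ k ∧ k < j ∧ s'[k]? = some e ∧ G.Adj e b := by
  induction h with
  | nil s =>
    intro i a hi ha
    rw [List.getElem?_eq_none hi] at ha
    cases ha
  | skip _ _ ih =>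
    intro j b hj hb
    exact (ih j b hj hb).imp_left (List.mem_cons_of_mem _)
  | @visit u us s s₁ s₂ ws hu hn hm hc hr ih1 ih2 =>
    intro j b hj hb
    have hl : s.length + 1 ≤ s₁.length := by simpa using hc.isPrefix.length_le
    rcases le_or_gt s₁.length j with h1 | h1
    · rcases ih2 j b h1 hb with h | ⟨k, e, hk, hkj, he, ha⟩
      · exact .inl (List.mem_cons_of_mem _ h)
      · exact .inr ⟨k, e, by omega, hkj, he, ha⟩
    · have hb1 := hr.isPrefix.getElem?_of_lt hb h1
      have h2 : s₁[s.length]? = some u := hc.isPrefix.getElem?_eq_some (by simp)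
      rcases hj.eq_or_lt with h0 | h0
      · rw [← h0] at hb1
        obtain rfl : b = u := by simpa [hb1] using h2
        exact .inl (by simp)
      · rcases ih1 j b (by simpa using h0) hb1 with h | ⟨k, e, hk, hkj, he, ha⟩
        · exact .inr ⟨s.length, u, le_rfl, h0, hr.isPrefix.getElem?_eq_some h2, (hm b).1 h⟩
        · refine .inr ⟨k, e, ?_, hkj, hr.isPrefix.getElem?_eq_some he, ha⟩
          simp at hk
          omega

/-- Positions in the list of discovered vertices play the role of labels. As long as `a` has the
undiscovered neighbor `c`, the call at `a` is still running, so a vertex `b` discovered meanwhile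
was found from `a` or from a vertex discovered after `a`. -/
theorem DFSLoop.exists_adj_of_jump {V : Type} {G : SimpleGraph V} {us s s' : List V}
    (h : DFSLoop G us s s') : ∀ i j a b c, s.length ≤ i → i < j → s'[i]? = some a →
      s'[j]? = some b → G.Adj a c → (∀ k ≤ j, s'[k]? ≠ some c) →
      ∃ k e, i ≤ k ∧ k < j ∧ s'[k]? = some e ∧ G.Adj e b := by
  induction h with
  | nil s =>
    intro i j a b c hi hij ha
    rw [List.getElem?_eq_none hi] at ha
    cases ha
  | skip _ _ ih => exact ih
  | @visit u us s s₁ s₂ ws hu hn hm hc hr ih1 ih2 =>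
    intro i j a b c hi hij ha hb hac hnc
    have h2 : s₁[s.length]? = some u := hc.isPrefix.getElem?_eq_some (by simp)
    rcases le_or_gt s₁.length i with h1 | h1
    · exact ih2 i j a b c h1 hij ha hb hac hnc
    · have ha1 := hr.isPrefix.getElem?_of_lt ha h1
      have hcl : ∀ x, G.Adj u x → x ∈ s₁ := fun x hx => hc.subset x ((hm x).2 hx)
      rcases le_or_gt s₁.length j with h3 | h3
      -- The call at `u` has discovered `a` and ended before `b` was found. By then all neighbors of
      -- `a` are discovered, so `c` would precede `b`.
      · exfalso
        have hcs : c ∈ s₁ := by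
          rcases hi.eq_or_lt with h0 | h0
          · rw [← h0] at ha1
            obtain rfl : a = u := by simpa [ha1] using h2
            exact hcl c hac
          · exact hc.closed i a c (by simpa using h0) ha1 hac
        obtain ⟨k, hk, hkc⟩ := List.getElem_of_mem hcs
        exact hnc k (by omega) (hr.isPrefix.getElem?_eq_some (by rw [List.getElem?_eq_getElem hk, hkc]))
      · have hb1 := hr.isPrefix.getElem?_of_lt hb h3
        rcases hi.eq_or_lt with h0 | h0
        · rw [← h0] at ha1
          obtain rfl : a = u := by simpa [ha1] using h2
          -- Now `a` is the root of the call that discovers `b`.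
          rcases hc.exists_adj j b (by simp; omega) hb1 with h | ⟨k, e, hk, hkj, he, hae⟩
          · exact ⟨i, a, le_rfl, hij, ha, (hm b).1 h⟩
          · simp at hk
            exact ⟨k, e, by omega, hkj, hr.isPrefix.getElem?_eq_some he, hae⟩
        · obtain ⟨k, e, hk, hkj, he, hae⟩ := ih1 i j a b c (by simpa using h0) hij ha1 hb1 hac
            (fun k hk h => hnc k hk (hr.isPrefix.getElem?_eq_some h))
          exact ⟨k, e, hk, hkj, hr.isPrefix.getElem?_eq_some he, hae⟩

theorem DFSLoop.not_violates {n : ℕ} {L : SimpleGraph (Fin n)} {us : List (Fin n)}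
    (h : DFSLoop L us [] (List.finRange n)) (a b c : Fin n) : ¬ Violates L a b c := by
  rintro ⟨hab, hbc, hac, hb⟩
  have hget : ∀ i : Fin n, (List.finRange n)[(i : ℕ)]? = some i := fun i => by simp
  obtain ⟨k, e, hk, hkj, he, hae⟩ := h.exists_adj_of_jump a b a b c (by simp) hab (hget a) (hget b)
    hac (fun k hk h => by
      obtain ⟨h1, h2⟩ := List.getElem?_eq_some_iff.1 h
      rw [List.getElem_finRange] at h2
      have : k = c.val := by rw [← h2]; rfl
      omega)
  obtain ⟨h1, h2⟩ := List.getElem?_eq_some_iff.1 he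
  rw [List.getElem_finRange] at h2
  have h3 : k = e.val := by rw [← h2]; rfl
  have := hb e hae (Fin.lt_def.2 (by omega))
  omega

/-! ### A labeling without violations is produced by some run of depth-first search. -/

section construction

variable {n : ℕ} {L : SimpleGraph (Fin n)}

/-- The labels from `k` up to `m` are those that a call at `k` should discover: take the least `m >
k` that is `n` or whose smaller neighbors all lie below `k`. -/
theorem exists_subtree_end (L : SimpleGraph (Fin n)) (k : Fin n) : ∃ m : ℕ, k < m ∧ m ≤ n ∧
    (∀ j : Fin n, k < j → j.val < m → ∃ e, L.Adj e j ∧ e < j ∧ k ≤ e) ∧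
    (∀ h : m < n, ∀ e, L.Adj e ⟨m, h⟩ → e < ⟨m, h⟩ → e < k) := by
  classical
  have hex : ∃ m : ℕ, k < m ∧ (∀ h : m < n, ∀ e, L.Adj e ⟨m, h⟩ → e < ⟨m, h⟩ → e < k) :=
    ⟨n, k.2, fun h => absurd h (lt_irrefl _)⟩
  refine ⟨Nat.find hex, (Nat.find_spec hex).1, ?_, ?_, (Nat.find_spec hex).2⟩
  · exact Nat.find_min' hex ⟨k.2, fun h => absurd h (lt_irrefl _)⟩
  · intro j hkj hj
    have := Nat.find_min hex hj
    push Not at this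
    obtain ⟨_, e, h1, h2, h3⟩ := this hkj
    exact ⟨e, h1, h2, h3⟩

theorem mem_take_finRange {k : ℕ} {i : Fin n} : i ∈ (List.finRange n).take k ↔ i.val < k := by
  rw [List.mem_take_iff_getElem]
  constructor
  · rintro ⟨j, hj, rfl⟩
    simp at hj ⊢
    omega
  · intro h
    exact ⟨i, by simp [h], by simp⟩

theorem take_finRange_succ (k : Fin n) :
    (List.finRange n).take (k + 1) = (List.finRange n).take k ++ [k] := by
  rw [List.take_add_one]
  simp

/-- The neighbors of `k` are tried in increasing order. Then the call discovers the labels of the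
interval `[k, m)` one after another, since each child of `k` opens a subtree that is again an
interval. The number `r` is only an induction parameter. -/
theorem dfsLoop_visit (hL : ∀ a b c, ¬ Violates L a b c) : ∀ (r : ℕ) (k : Fin n) (m : ℕ),
    n - k ≤ r → k < m → m ≤ n →
    (∀ j : Fin n, k < j → j.val < m → ∃ e, L.Adj e j ∧ e < j ∧ k ≤ e) →
    (∀ h : m < n, ∀ e, L.Adj e ⟨m, h⟩ → e < ⟨m, h⟩ → e < k) →
    ∃ ws : List (Fin n), ws.Nodup ∧ (∀ w, w ∈ ws ↔ L.Adj k w) ∧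
      DFSLoop L ws ((List.finRange n).take k ++ [k]) ((List.finRange n).take m) := by
  classical
  intro r
  induction r with
  | zero => intro k m h; omega
  | succ r ih =>
    intro k m hr hkm hmn hin hout
    -- An edge from `k` to a vertex beyond `m` would jump over `m`, whose smaller neighbors lie
    -- below `k`.
    have hnb : ∀ c, L.Adj k c → c.val < m := by
      intro c hc
      by_contra hcm
      have hm : m < n := by omega
      rcases (not_lt.1 hcm).eq_or_lt with h | h
      · have h1 : c = ⟨m, hm⟩ := Fin.ext h.symm
        have := hout hm k (h1 ▸ hc) (Fin.lt_def.2 hkm)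
        exact lt_irrefl _ this
      · exact hL k ⟨m, hm⟩ c ⟨Fin.lt_def.2 hkm, Fin.lt_def.2 h, hc, hout hm⟩
    -- Invariant of the inner loop: the labels below `j` are discovered, the untried list still
    -- contains all neighbors of `k` from `j` on, and `j`, if it belongs to the subtree, has no
    -- smaller neighbor above `k`. Hence `j` must be a child of `k`.
    have key : ∀ (ws : List (Fin n)) (j : ℕ), ws.Pairwise (· < ·) → (∀ w ∈ ws, L.Adj k w) →
        k.val < j → j ≤ m → (∀ w, L.Adj k w → j ≤ w.val → w ∈ ws) →
        (∀ h : j < n, j < m → ∀ e, L.Adj e ⟨j, h⟩ → e < ⟨j, h⟩ → e ≤ k) →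
        DFSLoop L ws ((List.finRange n).take j) ((List.finRange n).take m) := by
      intro ws
      induction ws with
      | nil =>
        intro j _ _ hkj hjm hall hcl
        rcases hjm.eq_or_lt with rfl | hlt
        · exact .nil _
        · exfalso
          have hjn : j < n := by omega
          obtain ⟨e, he1, he2, he3⟩ := hin ⟨j, hjn⟩ (Fin.lt_def.2 hkj) hlt
          obtain rfl : e = k := le_antisymm (hcl hjn hlt e he1 he2) he3
          exact absurd (hall _ he1 le_rfl) (by simp)
      | cons w ws ihw =>
        intro j hsort hadj hkj hjm hall hcl
        rcases lt_or_ge w.val j with hwj | hwj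
        · refine .skip (mem_take_finRange.2 hwj) (ihw j hsort.of_cons
            (fun x hx => hadj x (by simp [hx])) hkj hjm (fun x hx hjx => ?_) hcl)
          rcases List.mem_cons.1 (hall x hx hjx) with rfl | h
          · omega
          · exact h
        · have hwm : w.val < m := hnb w (hadj w (by simp))
          have hjn : j < n := by omega
          obtain ⟨e, he1, he2, he3⟩ := hin ⟨j, hjn⟩ (Fin.lt_def.2 hkj) (by simp; omega)
          obtain rfl : e = k := le_antisymm (hcl hjn (by omega) e he1 he2) he3
          -- As `j` is an untried neighbor of `k` and the list is sorted, it is the head.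
          have hjw : (⟨j, hjn⟩ : Fin n) = w := by
            rcases List.mem_cons.1 (hall _ he1 le_rfl) with h | h
            · exact h
            · have := List.rel_of_pairwise_cons hsort h
              exact absurd this (not_lt.2 (Fin.le_def.2 hwj))
          subst hjw
          obtain ⟨m', hm1, hm2, hm3, hm4⟩ := exists_subtree_end L ⟨j, hjn⟩
          simp only at hm1
          obtain ⟨vs, hvs1, hvs2, hvs3⟩ := ih ⟨j, hjn⟩ m' (by simp; omega) hm1 hm2 hm3 hm4
          have hm'm : m' ≤ m := by
            by_contra hlt
            have hmn' : m < n := by omega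
            obtain ⟨x, hx1, hx2, hx3⟩ := hm3 ⟨m, hmn'⟩ (Fin.lt_def.2 hwm) (by simp; omega)
            have := hout hmn' x hx1 hx2
            exact absurd (lt_of_lt_of_le this (le_trans (le_of_lt he2) hx3)) (lt_irrefl _)
          refine .visit vs (fun h => ?_) hvs1 hvs2 hvs3 (ihw m' hsort.of_cons
            (fun x hx => hadj x (by simp [hx])) (by omega) hm'm (fun x hx hjx => ?_) ?_)
          · simpa using mem_take_finRange.1 h
          · rcases List.mem_cons.1 (hall x hx (by omega)) with rfl | h
            · simp at hjx
              omega
            · exact h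
          -- The invariant survives the subtree of `j`: a neighbor `x` of `m'` strictly between `k`
          -- and `j` would give the violation `x`, `j`, `m'`.
          · intro h1 h2 x hx1 hx2
            by_contra hkx
            have hxj := hm4 h1 x hx1 hx2
            refine hL x ⟨j, hjn⟩ ⟨m', h1⟩ ⟨hxj, Fin.lt_def.2 hm1, hx1, fun y hy1 hy2 => ?_⟩
            exact lt_of_le_of_lt (hcl hjn (by omega) y hy1 hy2) (not_le.1 hkx)
    refine ⟨(List.finRange n).filter (L.Adj k ·), (List.nodup_finRange n).filter _, by simp, ?_⟩
    rw [← take_finRange_succ]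
    refine key _ _ ((List.pairwise_lt_finRange n).filter _) (by simp) (by omega) hkm
      (fun w hw _ => by simpa using hw) (fun h _ e _ he => ?_)
    rw [Fin.lt_def] at he
    rw [Fin.le_def]
    simp at he
    omega

theorem dfsLoop_finRange (hL : ∀ a b c, ¬ Violates L a b c) :
    DFSLoop L (List.finRange n) [] (List.finRange n) := by
  have key : ∀ (ws : List (Fin n)) (j : ℕ), ws.Pairwise (· < ·) → j ≤ n →
      (∀ w : Fin n, j ≤ w.val → w ∈ ws) →
      DFSLoop L ws ((List.finRange n).take j) (List.finRange n) := by
    intro ws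
    induction ws with
    | nil =>
      intro j _ hj hall
      have : j = n := by
        by_contra h
        exact absurd (hall ⟨j, by omega⟩ le_rfl) (by simp)
      subst this
      rw [List.take_of_length_le (by simp)]
      exact .nil _
    | cons w ws ihw =>
      intro j hsort hj hall
      rcases lt_or_ge w.val j with hwj | hwj
      · refine .skip (mem_take_finRange.2 hwj) (ihw j hsort.of_cons hj (fun x hjx => ?_))
        rcases List.mem_cons.1 (hall x hjx) with rfl | h
        · omega
        · exact h
      · have hjn : j < n := by omega
        have hjw : (⟨j, hjn⟩ : Fin n) = w := by
          rcases List.mem_cons.1 (hall ⟨j, hjn⟩ le_rfl) with h | h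
          · exact h
          · have := List.rel_of_pairwise_cons hsort h
            exact absurd this (not_lt.2 (Fin.le_def.2 hwj))
        subst hjw
        obtain ⟨m', hm1, hm2, hm3, hm4⟩ := exists_subtree_end L ⟨j, hjn⟩
        obtain ⟨vs, hvs1, hvs2, hvs3⟩ := dfsLoop_visit hL _ ⟨j, hjn⟩ m' le_rfl hm1 hm2 hm3 hm4
        simp only at hm1
        refine .visit vs (fun h => ?_) hvs1 hvs2 hvs3 (ihw m' hsort.of_cons hm2 fun x hx => ?_)
        · simpa using mem_take_finRange.1 h
        · rcases List.mem_cons.1 (hall x (by omega)) with rfl | h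
          · simp at hx
            omega
          · exact h
  simpa using key (List.finRange n) 0 (List.pairwise_lt_finRange n) (by simp) (by simp)

end construction

/-- The four-point characterization of DFS numberings. -/
theorem isDFSNumbering_iff {n : ℕ} (G : SimpleGraph (Fin n)) (num : Fin n ≃ Fin n) :
    IsDFSNumbering G num ↔ ∀ a b c, ¬ Violates (G.comap num.symm) a b c := by
  constructor
  · rintro ⟨order, s, -, -, hs, hnum⟩
    have h := hs.map (H := G.comap num.symm) num (by simp)
    rw [hnum] at h
    exact h.not_violates
  · intro h
    have h1 := (dfsLoop_finRange h).map (H := G) num.symm (by simp)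
    refine ⟨_, _, (List.nodup_finRange n).map num.symm.injective, fun v => ?_, h1, by simp⟩
    rw [List.mem_map]
    exact ⟨num v, by simp⟩

/-! ### Repairing a graph at a hitting set of its violations. -/

section repair

open Classical in
theorem card_filter_adj {n : ℕ} (L : SimpleGraph (Fin n)) (v : Fin n) :
    (Finset.univ.filter (L.Adj v)).card = (L.neighborSet v).ncard := by
  rw [← Set.ncard_coe_finset]
  congr 1
  ext w
  simp

/-- The graph without the edges at the vertices in `Z`. -/
def SimpleGraph.isolate {V : Type} (L : SimpleGraph V) (Z : Finset V) : SimpleGraph V where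
  Adj u v := L.Adj u v ∧ u ∉ Z ∧ v ∉ Z
  symm := ⟨fun _ _ h => ⟨h.1.symm, h.2.2, h.2.1⟩⟩
  loopless := ⟨fun v h => L.loopless.irrefl v h.1⟩

open Classical in
/-- A set of vertices together with all their neighbors. -/
noncomputable def closedNeighborhood {n : ℕ} (L : SimpleGraph (Fin n)) (Z : Finset (Fin n)) :
    Finset (Fin n) :=
  Z ∪ Z.biUnion fun z => Finset.univ.filter (L.Adj z)

variable {n d : ℕ} {L : SimpleGraph (Fin n)} {Z : Finset (Fin n)}

theorem card_closedNeighborhood_le (hdeg : ∀ v, (L.neighborSet v).ncard ≤ d) :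
    (closedNeighborhood L Z).card ≤ (d + 1) * Z.card := by
  classical
  have h1 : (Z.biUnion fun z => Finset.univ.filter (L.Adj z)).card ≤ Z.card * d :=
    Finset.card_biUnion_le_card_mul _ _ _ fun z _ => by rw [card_filter_adj]; exact hdeg z
  have h2 := Finset.card_union_le Z (Z.biUnion fun z => Finset.univ.filter (L.Adj z))
  unfold closedNeighborhood
  linarith

/-- Isolating `Z` can create violations, but only at middle vertices that lost an edge. Elsewhere
the triple was a violation before and meets `Z`, whereas the ends of a surviving edge avoid `Z`. -/
theorem mem_closedNeighborhood_of_violates_isolate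
    (hZ : ∀ a b c, Violates L a b c → a ∈ Z ∨ b ∈ Z ∨ c ∈ Z) {a b c : Fin n}
    (h : Violates (L.isolate Z) a b c) : b ∈ closedNeighborhood L Z := by
  classical
  obtain ⟨hab, hbc, hac, hb⟩ := h
  by_contra hbY
  simp only [closedNeighborhood, Finset.mem_union, Finset.mem_biUnion, Finset.mem_filter,
    Finset.mem_univ, true_and, not_or, not_exists, not_and] at hbY
  rcases hZ a b c ⟨hab, hbc, hac.1, fun e he heb =>
    hb e ⟨he, fun hz => hbY.2 e hz he, hbY.1⟩ heb⟩ with h | h | h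
  · exact hac.2.1 h
  · exact hbY.1 h
  · exact hac.2.2 h

/-- The predecessors of a set of vertices. -/
def predecessors (Y : Finset (Fin n)) : Finset (Fin n) :=
  Y.image fun y => ⟨y.val - 1, by omega⟩

theorem mem_predecessors {Y : Finset (Fin n)} {u y : Fin n} (hy : y ∈ Y) (h : u.val + 1 = y) :
    u ∈ predecessors Y :=
  Finset.mem_image.2 ⟨y, hy, Fin.ext (by simp; omega)⟩

/-- With degree at most one there is no room for attaching a vertex to its predecessor. Instead all
edges that join non-consecutive labels are deleted, after which no edge can jump over a vertex. -/
theorem exists_repair_of_le_one (hd : d ≤ 1) (hdeg : ∀ v, (L.neighborSet v).ncard ≤ d)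
    (hZ : ∀ a b c, Violates L a b c → a ∈ Z ∨ b ∈ Z ∨ c ∈ Z) :
    ∃ (L' : SimpleGraph (Fin n)) (W : Finset (Fin n)), (∀ v, (L'.neighborSet v).ncard ≤ d) ∧
      (∀ a b c, ¬ Violates L' a b c) ∧ W.card ≤ 5 * (d + 1) * Z.card ∧
      ∀ u v, ¬ (L.Adj u v ↔ L'.Adj u v) → u ∈ W ∨ v ∈ W := by
  classical
  let L' : SimpleGraph (Fin n) :=
    { Adj := fun u v => (L.isolate Z).Adj u v ∧ (u.val + 1 = v ∨ v.val + 1 = u)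
      symm := ⟨fun _ _ h => ⟨h.1.symm, h.2.symm⟩⟩
      loopless := ⟨fun v h => (L.isolate Z).loopless.irrefl v h.1⟩ }
  -- A long edge `a c` jumps over `a + 1`, which is not adjacent to `a` because `c` already uses up
  -- the degree of `a`. So `a + 1` is the middle of a violation.
  have hlong : ∀ a c, (L.isolate Z).Adj a c → a.val + 1 < c →
      a ∈ predecessors (closedNeighborhood L Z) := by
    intro a c hac hlt
    refine mem_predecessors (y := ⟨a + 1, by omega⟩)
      (mem_closedNeighborhood_of_violates_isolate hZ (a := a) (c := c) ?_) rfl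
    refine ⟨Fin.lt_def.2 (by simp), Fin.lt_def.2 hlt, hac, fun e he hlte => ?_⟩
    rcases lt_trichotomy e a with h | h | h
    · exact h
    · exfalso
      subst h
      have h2 : ({c, ⟨e + 1, by omega⟩} : Finset (Fin n)).card ≤ d := by
        rw [← Set.ncard_coe_finset]
        refine le_trans (Set.ncard_le_ncard ?_ (Set.toFinite _)) (hdeg e)
        intro x hx
        simp at hx
        rcases hx with rfl | rfl
        · exact hac.1
        · exact he.1
      rw [Finset.card_pair (by intro h; rw [h] at hlt; simp at hlt)] at h2
      omega
    · have h1 : e.val < a.val + 1 := hlte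
      omega
  refine ⟨L', Z ∪ predecessors (closedNeighborhood L Z), fun v => ?_, ?_, ?_, ?_⟩
  · refine le_trans (Set.ncard_le_ncard ?_ (Set.toFinite _)) (hdeg v)
    intro w hw
    exact hw.1.1
  · rintro a b c ⟨hab, hbc, hac, -⟩
    have := hac.2
    omega
  · have h1 := Finset.card_union_le Z (predecessors (closedNeighborhood L Z))
    have h2 : (predecessors (closedNeighborhood L Z)).card ≤ _ := Finset.card_image_le
    have h3 := card_closedNeighborhood_le (Z := Z) hdeg
    have h4 : 0 ≤ d * Z.card := Nat.zero_le _
    linarith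
  · have key : ∀ u v, u < v → ¬ (L.Adj u v ↔ L'.Adj u v) →
        u ∈ Z ∪ predecessors (closedNeighborhood L Z) ∨
        v ∈ Z ∪ predecessors (closedNeighborhood L Z) := by
      intro u v huv h
      by_contra hW
      simp only [Finset.mem_union, not_or] at hW
      refine h ⟨fun ha => ⟨⟨ha, hW.1.1, hW.2.1⟩, .inl ?_⟩, fun ha => ha.1.1⟩
      by_contra hne
      exact hW.1.2 (hlong u v ⟨ha, hW.1.1, hW.2.1⟩ (by omega))
    intro u v h
    rcases lt_trichotomy u v with huv | rfl | huv
    · exact key u v huv h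
    · exact absurd (by simp) h
    · exact (key v u huv (by rwa [L.adj_comm, L'.adj_comm])).symm

/-- The edges of the repaired graph, directed upwards: every vertex in `Y` becomes a neighbor of its
predecessor and of no other smaller vertex, and the predecessors of the vertices in `Y` keep only
their largest smaller neighbor. -/
def RepairRel (L₀ : SimpleGraph (Fin n)) (Y : Finset (Fin n)) (u v : Fin n) : Prop :=
  u < v ∧ ((u.val + 1 = v ∧ v ∈ Y) ∨ (L₀.Adj u v ∧ v ∉ Y ∧
    ((∃ x ∈ Y, v.val + 1 = x) → ∀ e, L₀.Adj e v → e < v → e ≤ u)))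

/-- The repaired graph. -/
def repairGraph (L₀ : SimpleGraph (Fin n)) (Y : Finset (Fin n)) : SimpleGraph (Fin n) where
  Adj u v := RepairRel L₀ Y u v ∨ RepairRel L₀ Y v u
  symm := ⟨fun _ _ h => h.symm⟩
  loopless := ⟨fun v h => by rcases h with h | h <;> exact lt_irrefl _ h.1⟩

/-- A vertex of `Y` cannot be a middle vertex, since it is adjacent to its predecessor. Any other
vertex keeps its largest smaller neighbor, and an edge that jumps over something is an old edge, so
a violation would come from `L₀`. -/
theorem not_violates_repairGraph {L₀ : SimpleGraph (Fin n)} {Y : Finset (Fin n)}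
    (hY : ∀ a b c, Violates L₀ a b c → b ∈ Y) (a b c : Fin n) :
    ¬ Violates (repairGraph L₀ Y) a b c := by
  rintro ⟨hab, hbc, hac, hb⟩
  have hac' : L₀.Adj a c := by
    rcases hac with h | h
    · rcases h.2 with h2 | h2
      · omega
      · exact h2.1
    · exact absurd (h.1.trans (hab.trans hbc)) (lt_irrefl _)
  have hbY : b ∉ Y := by
    intro hbY
    have h0 : 0 < b.val := by omega
    have := hb ⟨b - 1, by omega⟩ (.inl ⟨Fin.lt_def.2 (by simp; omega), .inl ⟨by simp; omega, hbY⟩⟩)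
      (Fin.lt_def.2 (by simp; omega))
    have h1 : b.val - 1 < a.val := this
    omega
  refine hbY (hY a b c ⟨hab, hbc, hac', fun e he heb => ?_⟩)
  classical
  obtain ⟨m, hm, hmax⟩ := Finset.exists_max_image
    (Finset.univ.filter fun e => L₀.Adj e b ∧ e < b) id ⟨e, by simp [he, heb]⟩
  simp only [Finset.mem_filter, Finset.mem_univ, true_and, id] at hm hmax
  refine lt_of_le_of_lt (hmax e ⟨he, heb⟩) (hb m (.inl ⟨hm.2, .inr ⟨hm.1, hbY, fun _ x hx hxb => ?_⟩⟩)
    hm.2)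
  exact hmax x ⟨hx, hxb⟩

open Classical in
-- Two kinds of vertices gain an edge. A vertex of `Y` trades all its smaller neighbors for one,
-- which fits by `hroom`. A predecessor of a vertex of `Y` gains this upper neighbor; by `hforw` it
-- loses another upper edge in exchange, unless it had none, and it keeps at most one lower
-- neighbor. The remaining extreme case, one neighbor on each side, is where `2 ≤ d` enters.
theorem card_repairGraph_le {L₀ : SimpleGraph (Fin n)} {Y : Finset (Fin n)} (hd : 2 ≤ d)
    (hdeg : ∀ v, (Finset.univ.filter (L₀.Adj v)).card ≤ d)
    (hroom : ∀ v ∈ Y, (Finset.univ.filter fun w => v < w ∧ L₀.Adj v w).card + 1 ≤ d)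
    (hforw : ∀ y v w : Fin n, v.val + 1 = y → y ∈ Y → v < w → L₀.Adj v w →
      ∃ w, v < w ∧ L₀.Adj v w ∧ w ∈ Y) (v : Fin n) :
    (Finset.univ.filter ((repairGraph L₀ Y).Adj v)).card ≤ d := by
  set F := Finset.univ.filter fun w => v < w ∧ L₀.Adj v w with hF
  set B := Finset.univ.filter fun w => w < v ∧ L₀.Adj v w with hB
  set F' := Finset.univ.filter fun w => RepairRel L₀ Y v w with hF'
  set B' := Finset.univ.filter fun w => RepairRel L₀ Y w v with hB'
  have hmF' : ∀ w, w ∈ F' ↔ RepairRel L₀ Y v w := fun w => by simp [hF']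
  have hmB' : ∀ w, w ∈ B' ↔ RepairRel L₀ Y w v := fun w => by simp [hB']
  have h1 : (Finset.univ.filter ((repairGraph L₀ Y).Adj v)).card ≤ F'.card + B'.card := by
    refine le_trans (Finset.card_le_card ?_) (Finset.card_union_le _ _)
    intro w hw
    rw [Finset.mem_union, hmF', hmB']
    exact (Finset.mem_filter.1 hw).2
  have h2 : F.card + B.card ≤ d := by
    rw [← Finset.card_union_of_disjoint]
    · refine le_trans (Finset.card_le_card ?_) (hdeg v)
      intro w hw
      simp [hF, hB] at hw ⊢
      tauto
    · rw [Finset.disjoint_left]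
      intro w hw hw'
      simp [hF, hB] at hw hw'
      exact absurd (hw.1.trans hw'.1) (lt_irrefl _)
  refine h1.trans ?_
  have hF1 : (∀ y ∈ Y, v.val + 1 ≠ y) → F'.card ≤ F.card := by
    intro hy
    refine Finset.card_le_card fun w hw => ?_
    rw [hmF'] at hw
    simp only [hF, Finset.mem_filter, Finset.mem_univ, true_and]
    rcases hw.2 with h | h
    · exact absurd h.1 (hy w h.2)
    · exact ⟨hw.1, h.1⟩
  have hF2 : ∀ y ∈ Y, v.val + 1 = y → F'.card ≤ max 1 F.card := by
    intro y hy hvy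
    have hsub : F' ⊆ insert y (F.filter (· ∉ Y)) := by
      intro w hw
      rw [hmF'] at hw
      simp only [hF, Finset.mem_filter, Finset.mem_univ, true_and, Finset.mem_insert]
      rcases hw.2 with h | h
      · exact .inl (Fin.ext (by omega))
      · exact .inr ⟨⟨hw.1, h.1⟩, h.2.1⟩
    have hc := (Finset.card_le_card hsub).trans (Finset.card_insert_le _ _)
    rcases F.eq_empty_or_nonempty with h0 | ⟨w, hw⟩
    · rw [h0] at hc
      simp at hc
      exact le_max_of_le_left hc
    · simp only [hF, Finset.mem_filter, Finset.mem_univ, true_and] at hw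
      obtain ⟨x, hx1, hx2, hx3⟩ := hforw y v w hvy hy hw.1 hw.2
      have : (F.filter (· ∉ Y)).card < F.card := by
        refine Finset.card_lt_card (Finset.filter_ssubset.2 ⟨x, ?_, by simpa using hx3⟩)
        simp [hF, hx1, hx2]
      exact le_max_of_le_right (by omega)
  by_cases hv : v ∈ Y
  · have hB1 : B'.card ≤ 1 := by
      rw [Finset.card_le_one]
      intro a ha b hb
      rw [hmB'] at ha hb
      rcases ha.2 with h | h
      · rcases hb.2 with h' | h'
        · exact Fin.ext (by omega)
        · exact absurd hv h'.2.1
      · exact absurd hv h.2.1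
    have hF3 : F.card + 1 ≤ d := by convert hroom v hv
    by_cases hy : ∃ y ∈ Y, v.val + 1 = y
    · obtain ⟨y, hy, hvy⟩ := hy
      have := hF2 y hy hvy
      omega
    · push Not at hy
      have := hF1 hy
      omega
  · have hB0 : B' ⊆ B := by
      intro w hw
      rw [hmB'] at hw
      simp only [hB, Finset.mem_filter, Finset.mem_univ, true_and]
      rcases hw.2 with h | h
      · exact absurd h.2 hv
      · exact ⟨hw.1, h.1.symm⟩
    have hB0' := Finset.card_le_card hB0
    by_cases hy : ∃ y ∈ Y, v.val + 1 = y
    · have hB1 : B'.card ≤ 1 := by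
        rw [Finset.card_le_one]
        intro a ha b hb
        rw [hmB'] at ha hb
        rcases ha.2 with h | h
        · exact absurd h.2 hv
        · rcases hb.2 with h' | h'
          · exact absurd h'.2 hv
          · exact le_antisymm (h'.2.2 hy a h.1 ha.1) (h.2.2 hy b h'.1 hb.1)
      obtain ⟨y, hy, hvy⟩ := hy
      have := hF2 y hy hvy
      omega
    · push Not at hy
      have := hF1 hy
      omega

/-- Let `Y₀` be the closed neighborhood of `Z`, which contains all middle vertices of violations
after `Z` is isolated. Attaching `Y₀` to the predecessors could overload them, so `Y₀` is first
enlarged by one upper neighbor of each predecessor. This doubles the set at most, and `W` doubles it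
again, so that 4 (d + 1) |Z| vertices suffice. -/
theorem exists_repair_of_two_le (hd : 2 ≤ d) (hdeg : ∀ v, (L.neighborSet v).ncard ≤ d)
    (hZ : ∀ a b c, Violates L a b c → a ∈ Z ∨ b ∈ Z ∨ c ∈ Z) :
    ∃ (L' : SimpleGraph (Fin n)) (W : Finset (Fin n)), (∀ v, (L'.neighborSet v).ncard ≤ d) ∧
      (∀ a b c, ¬ Violates L' a b c) ∧ W.card ≤ 5 * (d + 1) * Z.card ∧
      ∀ u v, ¬ (L.Adj u v ↔ L'.Adj u v) → u ∈ W ∨ v ∈ W := by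
  classical
  set L₀ := L.isolate Z with hL₀
  set Y₀ := closedNeighborhood L Z with hY₀
  have hviol : ∀ a b c, Violates L₀ a b c → b ∈ Y₀ :=
    fun a b c h => mem_closedNeighborhood_of_violates_isolate hZ h
  -- The vertex `f c` is an upper neighbor of the predecessor of `c`; if there is none, the default
  -- `c` adds nothing new.
  have hch : ∀ c : Fin n, ∃ w, (∃ y : Fin n, y.val + 1 = c ∧ y < w ∧ L₀.Adj y w) ∨
      (w = c ∧ ∀ y w' : Fin n, y.val + 1 = c → y < w' → ¬ L₀.Adj y w') := by
    intro c
    by_cases h : ∃ w y : Fin n, y.val + 1 = c ∧ y < w ∧ L₀.Adj y w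
    · obtain ⟨w, hw⟩ := h
      exact ⟨w, .inl hw⟩
    · push Not at h
      exact ⟨c, .inr ⟨rfl, fun y w' => h w' y⟩⟩
  choose f hf using hch
  set Y := Y₀ ∪ Y₀.image f with hY
  have hZY₀ : Z ⊆ Y₀ := Finset.subset_union_left
  have hdeg₀ : ∀ v, (Finset.univ.filter (L₀.Adj v)).card ≤ d := by
    intro v
    refine le_trans (Finset.card_le_card ?_) ((card_filter_adj L v).trans_le (hdeg v))
    intro w hw
    simp at hw ⊢
    exact hw.1
  have hlt : ∀ v z, L.Adj v z → ¬ (v < z ∧ L₀.Adj v z) →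
      (Finset.univ.filter fun w => v < w ∧ L₀.Adj v w).card + 1 ≤ d := by
    intro v z hz hnz
    refine le_trans (Nat.succ_le_of_lt (Finset.card_lt_card ?_))
      ((card_filter_adj L v).trans_le (hdeg v))
    rw [Finset.ssubset_iff_of_subset]
    · exact ⟨z, by simpa using hz, by simpa using hnz⟩
    · intro w hw
      simp at hw ⊢
      exact hw.2.1
  have hroom₀ : ∀ v ∈ Y₀, (Finset.univ.filter fun w => v < w ∧ L₀.Adj v w).card + 1 ≤ d := by
    intro v hv
    simp only [hY₀, closedNeighborhood, Finset.mem_union, Finset.mem_biUnion, Finset.mem_filter,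
      Finset.mem_univ, true_and] at hv
    rcases hv with hv | ⟨z, hz, hzv⟩
    · rw [Finset.filter_eq_empty_iff.2]
      · simp
        omega
      · rintro w - ⟨-, hw⟩
        exact hw.2.1 hv
    · exact hlt v z hzv.symm fun h => h.2.2.2 hz
  have hroom : ∀ v ∈ Y, (Finset.univ.filter fun w => v < w ∧ L₀.Adj v w).card + 1 ≤ d := by
    intro v hv
    rcases Finset.mem_union.1 hv with hv | hv
    · exact hroom₀ v hv
    · obtain ⟨c, hc, rfl⟩ := Finset.mem_image.1 hv
      rcases hf c with ⟨y, -, hy, hyf⟩ | ⟨h, -⟩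
      · exact hlt _ y hyf.1.symm fun h => absurd (h.1.trans hy) (lt_irrefl _)
      · rw [h]
        exact hroom₀ c hc
  have hforw : ∀ y v w : Fin n, v.val + 1 = y → y ∈ Y → v < w → L₀.Adj v w →
      ∃ w, v < w ∧ L₀.Adj v w ∧ w ∈ Y := by
    intro y v w hvy hyY hvw hadj
    by_cases hy0 : y ∈ Y₀
    · rcases hf y with ⟨v', hv', hlt', hadj'⟩ | ⟨-, h⟩
      · obtain rfl : v' = v := Fin.ext (by omega)
        exact ⟨f y, hlt', hadj', Finset.mem_union_right _ (Finset.mem_image_of_mem f hy0)⟩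
      · exact absurd hadj (h v w hvy hvw)
    -- For `y` outside `Y₀` no further enlargement is needed: its predecessor `v` is adjacent to `y`
    -- itself, since otherwise the edge `v w` would jump over `y` and put `y` into `Y₀`.
    · refine ⟨y, Fin.lt_def.2 (by omega), ?_, hyY⟩
      by_cases hwy : w = y
      · exact hwy ▸ hadj
      · by_contra hna
        refine hy0 (hviol v y w ⟨Fin.lt_def.2 (by omega), Fin.lt_def.2 ?_, hadj, fun e he hey => ?_⟩)
        · have : w.val ≠ y.val := fun h => hwy (Fin.ext h)
          omega
        · rw [Fin.lt_def]
          have : e.val ≠ v.val := fun h => hna (Fin.ext h ▸ he)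
          omega
  refine ⟨repairGraph L₀ Y, Y ∪ predecessors Y, fun v => ?_, not_violates_repairGraph
    fun a b c h => Finset.mem_union_left _ (hviol a b c h), ?_, ?_⟩
  · rw [← card_filter_adj]
    exact card_repairGraph_le hd hdeg₀ hroom hforw v
  · have h1 := Finset.card_union_le Y (predecessors Y)
    have h2 : (predecessors Y).card ≤ _ := Finset.card_image_le
    have h3 := card_closedNeighborhood_le (Z := Z) hdeg
    have h4 := Finset.card_union_le Y₀ (Y₀.image f)
    have h5 : (Y₀.image f).card ≤ Y₀.card := Finset.card_image_le
    have h6 : 0 ≤ (d + 1) * Z.card := Nat.zero_le _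
    rw [← hY₀] at h3
    rw [← hY] at h4
    linarith
  · have key : ∀ u v, u < v → ¬ (L.Adj u v ↔ (repairGraph L₀ Y).Adj u v) →
        u ∈ Y ∪ predecessors Y ∨ v ∈ Y ∪ predecessors Y := by
      intro u v huv h
      by_contra hW
      simp only [Finset.mem_union (s := Y) (t := predecessors Y), not_or] at hW
      have hz : ∀ x, x ∉ Y → x ∉ Z := fun x hx hxZ => hx (Finset.mem_union_left _ (hZY₀ hxZ))
      refine h ⟨fun ha => .inl ⟨huv, .inr ⟨⟨ha, hz u hW.1.1, hz v hW.2.1⟩, hW.2.1, ?_⟩⟩,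
        fun ha => ?_⟩
      · rintro ⟨x, hx, hvx⟩
        exact absurd (mem_predecessors hx hvx) hW.2.2
      · rcases ha with ⟨-, h | h⟩ | ⟨h, -⟩
        · exact absurd h.2 hW.2.1
        · exact h.1.1
        · exact absurd (h.trans huv) (lt_irrefl _)
    intro u v h
    rcases lt_trichotomy u v with huv | rfl | huv
    · exact key u v huv h
    · exact absurd (by simp) h
    · exact (key v u huv (by rwa [L.adj_comm, (repairGraph L₀ Y).adj_comm])).symm

/-- If all violations can be hit by few vertices, then few edge modifications, which respect the
degree bound, remove all violations. -/
theorem exists_repair (hdeg : ∀ v, (L.neighborSet v).ncard ≤ d)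
    (hZ : ∀ a b c, Violates L a b c → a ∈ Z ∨ b ∈ Z ∨ c ∈ Z) :
    ∃ (L' : SimpleGraph (Fin n)) (W : Finset (Fin n)), (∀ v, (L'.neighborSet v).ncard ≤ d) ∧
      (∀ a b c, ¬ Violates L' a b c) ∧ W.card ≤ 5 * (d + 1) * Z.card ∧
      ∀ u v, ¬ (L.Adj u v ↔ L'.Adj u v) → u ∈ W ∨ v ∈ W := by
  rcases le_or_gt d 1 with hd | hd
  · exact exists_repair_of_le_one hd hdeg hZ
  · exact exists_repair_of_two_le hd hdeg hZ

end repair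

/-! ### A calculus of functions that can be evaluated with few queries. -/

section queries

variable {n d : ℕ} {α β : Type}

/-- The function `f` of the input can be evaluated with at most `k` queries. -/
def Queryable (k : ℕ) (f : LabeledGraph n d → α) : Prop :=
  ∃ c : (α → QueryAlgorithm n d) → QueryAlgorithm n d, ∀ X κ,
    (c κ).run X = (κ (f X)).run X ∧ (c κ).queries X ≤ k + (κ (f X)).queries X

theorem Queryable.pure (a : α) : Queryable 0 fun _ : LabeledGraph n d => a :=
  ⟨fun κ => κ a, fun _ _ => ⟨rfl, by simp⟩⟩

theorem Queryable.mono {k k' : ℕ} {f : LabeledGraph n d → α} (h : Queryable k f) (hk : k ≤ k') :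
    Queryable k' f := by
  obtain ⟨c, hc⟩ := h
  exact ⟨c, fun X κ => ⟨(hc X κ).1, (hc X κ).2.trans (by omega)⟩⟩

/-- The second cost bound is required only at values `f X` that really occur. This is what allows
bounds such as `d` for the length of an adjacency list. -/
theorem Queryable.bind {k k' : ℕ} {f : LabeledGraph n d → α} {g : α → LabeledGraph n d → β}
    (hf : Queryable k f) (hg : ∀ X, Queryable k' (g (f X))) :
    Queryable (k + k') fun X => g (f X) X := by
  classical
  obtain ⟨c, hc⟩ := hf
  choose e he using hg
  -- The verdict `true` is a dummy for answers that no input produces.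
  refine ⟨fun κ => c fun a => if h : ∃ X, f X = a then e h.choose κ else .halt true,
    fun X κ => ?_⟩
  have hX : ∃ Y, f Y = f X := ⟨X, rfl⟩
  have h1 := he hX.choose X κ
  rw [hX.choose_spec] at h1
  have h2 := hc X fun a => if h : ∃ X, f X = a then e h.choose κ else .halt true
  simp only [hX, dif_pos] at h2
  refine ⟨h2.1.trans h1.1, h2.2.trans ?_⟩
  rw [add_assoc]
  exact Nat.add_le_add_left h1.2 k

theorem Queryable.map {k : ℕ} {f : LabeledGraph n d → α} (hf : Queryable k f) (g : α → β) :
    Queryable k fun X => g (f X) :=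
  hf.bind (g := fun a _ => g a) (k' := 0) fun X => .pure (g (f X))

/-- From the answers that determine `f X`, pick any input compatible with them and evaluate `g`
there. Thus local quantities need no explicit algorithm, only a proof that they depend on the
queried data alone. -/
theorem Queryable.of_factors {k : ℕ} {f : LabeledGraph n d → α} {g : LabeledGraph n d → β}
    (hf : Queryable k f) (h : ∀ X Y, f X = f Y → g X = g Y) : Queryable k g := by
  classical
  obtain ⟨c, hc⟩ := hf
  refine ⟨fun κ => c fun a => if h : ∃ X, f X = a then κ (g h.choose) else .halt true,
    fun X κ => ?_⟩
  have hX : ∃ Y, f Y = f X := ⟨X, rfl⟩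
  have h2 := hc X fun a => if h : ∃ X, f X = a then κ (g h.choose) else .halt true
  simp only [hX, dif_pos] at h2
  rwa [h _ _ hX.choose_spec] at h2

theorem Queryable.prod {k k' : ℕ} {f : LabeledGraph n d → α} {g : LabeledGraph n d → β}
    (hf : Queryable k f) (hg : Queryable k' g) : Queryable (k + k') fun X => (f X, g X) :=
  hf.bind (g := fun a X => (a, g X)) fun X => hg.map fun b => (f X, b)

theorem Queryable.listMap {k : ℕ} {f : β → LabeledGraph n d → α} (l : List β)
    (h : ∀ b ∈ l, Queryable k (f b)) : Queryable (l.length * k) fun X => l.map fun b => f b X := by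
  induction l with
  | nil => exact (Queryable.pure []).mono (Nat.zero_le _)
  | cons b l ih =>
    have h1 := (h b (by simp)).prod (ih fun b hb => h b (by simp [hb]))
    refine (h1.map fun p => p.1 :: p.2).mono ?_
    simp only [List.length_cons]
    linarith

theorem Queryable.exists_algorithm {k : ℕ} {f : LabeledGraph n d → Bool} (h : Queryable k f) :
    ∃ A : QueryAlgorithm n d, ∀ X, A.run X = f X ∧ A.queries X ≤ k := by
  obtain ⟨c, hc⟩ := h
  refine ⟨c .halt, fun X => ?_⟩
  simpa [QueryAlgorithm.run, QueryAlgorithm.queries] using hc X .halt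

theorem queryable_num (v : Fin n) : Queryable 1 fun X : LabeledGraph n d => X.num v :=
  ⟨fun κ => .labelQuery v κ, fun _ _ => ⟨rfl, by simp [QueryAlgorithm.queries, add_comm]⟩⟩

theorem queryable_neighbor (v : Fin n) (i : Fin d) :
    Queryable 1 fun X : LabeledGraph n d => (X.adjList v)[(i : ℕ)]? :=
  ⟨fun κ => .neighborQuery v i κ, fun _ _ => ⟨rfl, by simp [QueryAlgorithm.queries, add_comm]⟩⟩

theorem reduceOption_map_finRange (l : List α) (m : ℕ) (h : l.length ≤ m) :
    ((List.finRange m).map fun i : Fin m => l[(i : ℕ)]?).reduceOption = l := by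
  induction l generalizing m with
  | nil => simp [List.reduceOption]
  | cons a l ih =>
    obtain ⟨m, rfl⟩ : ∃ k, m = k + 1 := ⟨m - 1, by simp at h; omega⟩
    rw [List.finRange_succ]
    simp only [List.map_cons, List.map_map, Fin.val_zero, List.getElem?_cons_zero,
      List.reduceOption_cons_of_some]
    congr 1
    convert ih m (by simpa using h) using 2
    exact List.map_congr_left fun i _ => by simp

theorem queryable_adjList (v : Fin n) : Queryable d fun X : LabeledGraph n d => X.adjList v := by
  have h := (Queryable.listMap (List.finRange d) fun i _ => queryable_neighbor v i).map
    List.reduceOption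
  simp only [List.length_finRange, mul_one] at h
  convert h using 2 with X
  exact (reduceOption_map_finRange _ _ (X.adjList_length v)).symm

end queries

/-! ### The reverse walk through the labels, and its query cost. -/

section walk

variable {n d : ℕ}

namespace LabeledGraph

/-- The vertex with the largest label in a set. -/
noncomputable def lastOf (X : LabeledGraph n d) (S : Fin n → Prop) : Option (Fin n) :=
  open Classical in
  if h : ∃ v, S v ∧ ∀ u, S u → X.num u ≤ X.num v then some h.choose else none

theorem lastOf_eq_some {X : LabeledGraph n d} {S : Fin n → Prop} {v : Fin n} :
    X.lastOf S = some v ↔ S v ∧ ∀ u, S u → X.num u ≤ X.num v := by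
  unfold lastOf
  constructor
  · intro h
    split_ifs at h with h'
    cases h
    exact h'.choose_spec
  · intro h
    have h' : ∃ v, S v ∧ ∀ u, S u → X.num u ≤ X.num v := ⟨v, h⟩
    rw [dif_pos h']
    exact congrArg some (X.num.injective
      (le_antisymm (h.2 _ h'.choose_spec.1) (h'.choose_spec.2 _ h.1)))

theorem lastOf_eq_none {X : LabeledGraph n d} {S : Fin n → Prop} :
    X.lastOf S = none ↔ ∀ v, ¬ S v := by
  classical
  unfold lastOf
  constructor
  · intro h v hv
    split_ifs at h with h'
    obtain ⟨m, hm, hmax⟩ := Finset.exists_max_image (Finset.univ.filter S) X.num ⟨v, by simpa⟩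
    exact h' ⟨m, by simpa using hm, fun u hu => hmax u (by simpa using hu)⟩
  · intro h
    rw [dif_neg]
    rintro ⟨v, hv, -⟩
    exact h v hv

theorem lastOf_congr {X Y : LabeledGraph n d} {S S' : Fin n → Prop} (hS : ∀ v, S v ↔ S' v)
    (hnum : ∀ v, S v → X.num v = Y.num v) : X.lastOf S = Y.lastOf S' := by
  obtain rfl : S = S' := funext fun v => propext (hS v)
  ext v
  simp only [lastOf_eq_some]
  refine and_congr_right fun hv => forall_congr' fun u => imp_congr_right fun hu => ?_
  rw [hnum u hu, hnum v hv]

/-- The neighbor with the largest label below the label of `y`. -/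
noncomputable def parent (X : LabeledGraph n d) (y : Fin n) : Option (Fin n) :=
  X.lastOf fun u => X.graph.Adj y u ∧ X.num u < X.num y

/-- The vertex that precedes `y` among the vertices with parent `q`. -/
noncomputable def prevSibling (X : LabeledGraph n d) (q y : Fin n) : Option (Fin n) :=
  X.lastOf fun u => (X.graph.Adj q u ∧ X.parent u = some q) ∧ X.num u < X.num y

/-- The vertex with the largest label among the vertices with parent `q`. -/
noncomputable def lastChild (X : LabeledGraph n d) (q : Fin n) : Option (Fin n) :=
  X.lastOf fun u => X.graph.Adj q u ∧ X.parent u = some q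

/-- The labels of `v` and its neighbors. -/
def info (X : LabeledGraph n d) (v : Fin n) : Fin n × List (Fin n × Fin n) :=
  (X.num v, (X.adjList v).map fun u => (u, X.num u))

/-- The labels of all vertices at distance at most two from `v`. -/
def info₂ (X : LabeledGraph n d) (v : Fin n) :
    (Fin n × List (Fin n × Fin n)) × List (Fin n × List (Fin n × Fin n)) :=
  (X.info v, (X.adjList v).map X.info)

theorem adjList_eq_of_info_eq {X Y : LabeledGraph n d} {v : Fin n} (h : X.info v = Y.info v) :
    X.adjList v = Y.adjList v := by
  have h2 := congrArg (fun p => p.2.map Prod.fst) h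
  simpa [info, Function.comp_def] using h2

theorem num_eq_of_info_eq {X Y : LabeledGraph n d} {v : Fin n} (h : X.info v = Y.info v) :
    X.num v = Y.num v :=
  congrArg Prod.fst h

theorem adj_iff_of_info_eq {X Y : LabeledGraph n d} {v : Fin n} (h : X.info v = Y.info v)
    (u : Fin n) : X.graph.Adj v u ↔ Y.graph.Adj v u := by
  rw [← X.mem_adjList, ← Y.mem_adjList, adjList_eq_of_info_eq h]

theorem num_eq_of_info_eq_of_adj {X Y : LabeledGraph n d} {v : Fin n} (h : X.info v = Y.info v)
    {u : Fin n} (hu : X.graph.Adj v u) : X.num u = Y.num u := by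
  have h2 := congrArg Prod.snd h
  simp only [info, adjList_eq_of_info_eq h] at h2
  rw [List.map_inj_left] at h2
  have := h2 u ((Y.mem_adjList v u).2 ((adj_iff_of_info_eq h u).1 hu))
  exact congrArg Prod.snd this

theorem parent_eq_of_info_eq {X Y : LabeledGraph n d} {v : Fin n} (h : X.info v = Y.info v) :
    X.parent v = Y.parent v := by
  refine lastOf_congr (fun u => ?_) fun u hu => num_eq_of_info_eq_of_adj h hu.1
  rw [adj_iff_of_info_eq h, num_eq_of_info_eq h]
  exact and_congr_right fun hu => by
    rw [num_eq_of_info_eq_of_adj h ((adj_iff_of_info_eq h u).2 hu)]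

theorem info_eq_of_info₂_eq {X Y : LabeledGraph n d} {v u : Fin n} (h : X.info₂ v = Y.info₂ v)
    (hu : X.graph.Adj v u) : X.info u = Y.info u := by
  have h2 := congrArg Prod.snd h
  have h1 : X.info v = Y.info v := congrArg Prod.fst h
  simp only [info₂, adjList_eq_of_info_eq h1] at h2
  rw [List.map_inj_left] at h2
  exact h2 u ((Y.mem_adjList v u).2 ((adj_iff_of_info_eq h1 u).1 hu))

/-- Whether a neighbor of `q` is a child of `q` depends on the labels of its own neighbors; hence
distance two. -/
theorem child_iff_of_info₂_eq {X Y : LabeledGraph n d} {q : Fin n} (h : X.info₂ q = Y.info₂ q)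
    (u : Fin n) : X.graph.Adj q u ∧ X.parent u = some q ↔ Y.graph.Adj q u ∧ Y.parent u = some q := by
  rw [← adj_iff_of_info_eq (congrArg Prod.fst h)]
  exact and_congr_right fun hu => by rw [parent_eq_of_info_eq (info_eq_of_info₂_eq h hu)]

theorem queryable_info (v : Fin n) :
    Queryable (2 * d + 1) fun X : LabeledGraph n d => X.info v := by
  have h : Queryable (d + d * 1) fun X : LabeledGraph n d =>
      (X.adjList v).map fun u => (u, X.num u) := by
    refine (queryable_adjList v).bind (g := fun l X => l.map fun u => (u, X.num u)) fun X => ?_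
    exact (Queryable.listMap _ fun u _ => (queryable_num u).map fun a => (u, a)).mono
      (Nat.mul_le_mul_right _ (X.adjList_length v))
  exact ((queryable_num v).prod h).mono (by omega)

theorem queryable_info₂ (v : Fin n) : Queryable ((2 * d + 1) + (d + d * (2 * d + 1)))
    fun X : LabeledGraph n d => X.info₂ v := by
  refine (queryable_info v).prod ?_
  refine (queryable_adjList v).bind (g := fun l X => l.map fun u => X.info u) fun X => ?_
  exact (Queryable.listMap _ fun u _ => queryable_info u).mono
      (Nat.mul_le_mul_right _ (X.adjList_length v))

theorem queryable_parent (v : Fin n) :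
    Queryable (2 * d + 1) fun X : LabeledGraph n d => X.parent v :=
  (queryable_info v).of_factors fun _ _ => parent_eq_of_info_eq

theorem queryable_lastChild (v : Fin n) : Queryable ((2 * d + 1) + (d + d * (2 * d + 1)))
    fun X : LabeledGraph n d => X.lastChild v :=
  (queryable_info₂ v).of_factors fun _ _ h => lastOf_congr (child_iff_of_info₂_eq h)
    fun _ hu => num_eq_of_info_eq_of_adj (congrArg Prod.fst h) hu.1

theorem queryable_prevSibling (q y : Fin n) : Queryable ((2 * d + 1) + (d + d * (2 * d + 1)) + 1)
    fun X : LabeledGraph n d => X.prevSibling q y := by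
  refine ((queryable_info₂ q).prod (queryable_num y)).of_factors fun X Y h => ?_
  have h1 : X.info₂ q = Y.info₂ q := congrArg Prod.fst h
  have h2 : X.num y = Y.num y := congrArg Prod.snd h
  have h3 : ∀ u, X.graph.Adj q u → X.num u = Y.num u :=
    fun u hu => num_eq_of_info_eq_of_adj (congrArg Prod.fst h1) hu
  refine lastOf_congr (fun u => ?_) fun u hu => h3 u hu.1.1
  rw [← child_iff_of_info₂_eq h1, h2]
  exact and_congr_right fun hu => by rw [h3 u hu.1]

/-- Depth-first search in reverse, with limited fuel. In the state `none`, the walk is at a vertex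
`v` and looks for the vertex whose label precedes the label of `v`; in the state `some y` it descends
to last children, looking for the vertex whose label precedes the label of `y`. The result is the list
of the vertices visited in the state `none`, or `none` if the search for a predecessor fails. -/
noncomputable def walk (X : LabeledGraph n d) : ℕ → Option (Fin n) → Fin n → Option (List (Fin n))
  | 0, none, v => some [v]
  | 0, some _, _ => some []
  | k + 1, none, v =>
    match X.parent v with
    | none => some [v]
    | some q =>
      if (X.num q).val + 1 = X.num v then (X.walk k none q).map (v :: ·)
      else
        match X.prevSibling q v with
        | none => none
        | some z => (X.walk k (some v) z).map (v :: ·)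
  | k + 1, some y, v =>
    match X.lastChild v with
    | some w => X.walk k (some y) w
    | none => if (X.num v).val + 1 = X.num y then X.walk k none v else none

theorem length_walk_le (X : LabeledGraph n d) (k : ℕ) (t : Option (Fin n)) (v : Fin n)
    (l : List (Fin n)) (h : X.walk k t v = some l) : l.length ≤ k + 1 := by
  induction k generalizing t v l with
  | zero =>
    cases t <;> · simp only [walk, Option.some.injEq] at h; subst h; simp
  | succ k ih =>
    cases t with
    | none =>
      rw [walk] at h
      split at h
      · cases h; simp
      · split_ifs at h
        · simp only [Option.map_eq_some_iff] at h
          obtain ⟨l', hl', rfl⟩ := h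
          simpa using ih _ _ _ hl'
        · split at h
          · cases h
          · simp only [Option.map_eq_some_iff] at h
            obtain ⟨l', hl', rfl⟩ := h
            simpa using ih _ _ _ hl'
    | some y =>
      rw [walk] at h
      split at h
      · exact (ih _ _ _ h).trans (by omega)
      · split_ifs at h
        exact (ih _ _ _ h).trans (by omega)

/-- A bound for the number of queries in one step of the walk. -/
def stepCost (d : ℕ) : ℕ := (2 * d + 1) + (2 + ((2 * d + 1) + (d + d * (2 * d + 1)) + 1))

theorem queryable_precedes (u v : Fin n) : Queryable 2
    fun X : LabeledGraph n d => decide ((X.num u).val + 1 = X.num v) :=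
  ((queryable_num u).prod (queryable_num v)).map fun p => decide (p.1.val + 1 = p.2)

/-- Each unit of fuel pays for one parent or last-child lookup, one comparison of labels and
possibly one sibling lookup. -/
theorem queryable_walk (k : ℕ) (t : Option (Fin n)) (v : Fin n) :
    Queryable (k * stepCost d) fun X : LabeledGraph n d => X.walk k t v := by
  induction k generalizing t v with
  | zero =>
    cases t <;> exact (Queryable.pure _).mono (Nat.zero_le _)
  | succ k ih =>
    have hite : ∀ (p q : Fin n) (f g : LabeledGraph n d → Option (List (Fin n))) (m : ℕ),
        Queryable m f → Queryable m g →
        Queryable (2 + m) fun X => if (X.num p).val + 1 = X.num q then f X else g X := by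
      intro p q f g m hf hg
      have := (queryable_precedes (d := d) p q).bind
        (g := fun b X => if b = true then f X else g X) (k' := m) fun X => by
          cases decide ((X.num p).val + 1 = X.num q) <;> simpa
      simpa using this
    cases t with
    | none =>
      have h2 : ∀ q, Queryable (2 + (((2 * d + 1) + (d + d * (2 * d + 1)) + 1) + k * stepCost d))
          fun X : LabeledGraph n d =>
          if (X.num q).val + 1 = X.num v then (X.walk k none q).map (v :: ·)
          else match X.prevSibling q v with
            | none => none
            | some z => (X.walk k (some v) z).map (v :: ·) := by
        intro q
        refine hite q v _ _ _ (((ih none q).map _).mono (by omega)) ?_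
        refine (queryable_prevSibling q v).bind (g := fun a X => match a with
            | none => none
            | some z => (X.walk k (some v) z).map (v :: ·)) fun X => ?_
        cases X.prevSibling q v with
        | none => exact (Queryable.pure _).mono (Nat.zero_le _)
        | some z => exact (ih (some v) z).map _
      have h3 := (queryable_parent (d := d) v).bind (g := fun a X => match a with
        | none => some [v]
        | some q =>
          if (X.num q).val + 1 = X.num v then (X.walk k none q).map (v :: ·)
          else match X.prevSibling q v with
            | none => none
            | some z => (X.walk k (some v) z).map (v :: ·))
        (k' := (2 + (((2 * d + 1) + (d + d * (2 * d + 1)) + 1) + k * stepCost d))) fun X => by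
          cases X.parent v with
          | none => exact (Queryable.pure _).mono (Nat.zero_le _)
          | some q => exact h2 q
      simp only [walk]
      refine h3.mono ?_
      have hs : stepCost d = (2 * d + 1) + (2 + ((2 * d + 1) + (d + d * (2 * d + 1)) + 1)) := rfl
      rw [Nat.add_one_mul]
      linarith
    | some y =>
      have h3 := (queryable_lastChild (d := d) v).bind (g := fun a X => match a with
        | some w => X.walk k (some y) w
        | none => if (X.num v).val + 1 = X.num y then X.walk k none v else none)
        (k' := 2 + k * stepCost d) fun X => by
          cases X.lastChild v with
          | none => exact hite v y _ _ _ (ih none v) ((Queryable.pure _).mono (Nat.zero_le _))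
          | some w => exact (ih (some y) w).mono (by omega)
      simp only [walk]
      refine h3.mono ?_
      have hs : stepCost d = (2 * d + 1) + (2 + ((2 * d + 1) + (d + d * (2 * d + 1)) + 1)) := rfl
      rw [Nat.add_one_mul]
      linarith

/-- An edge at `u` jumps over `v`, although `v` has no neighbor in between. -/
def SeesViolation (X : LabeledGraph n d) (u v : Fin n) : Prop :=
  ∃ w, X.graph.Adj u w ∧ min (X.num u) (X.num w) < X.num v ∧ X.num v < max (X.num u) (X.num w) ∧
    ∀ e, X.graph.Adj v e → X.num e < X.num v → X.num e < min (X.num u) (X.num w)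

/-- No violation can be seen from the neighborhoods of the vertices in the list. -/
def Consistent (X : LabeledGraph n d) (l : List (Fin n)) : Prop :=
  ∀ u ∈ l, ∀ v ∈ l, ¬ X.SeesViolation u v

theorem seesViolation_iff_of_info_eq {X Y : LabeledGraph n d} {u v : Fin n}
    (hu : X.info u = Y.info u) (hv : X.info v = Y.info v) :
    X.SeesViolation u v ↔ Y.SeesViolation u v := by
  unfold SeesViolation
  refine exists_congr fun w => ?_
  rw [← adj_iff_of_info_eq hu, ← num_eq_of_info_eq hu, ← num_eq_of_info_eq hv]
  refine and_congr_right fun hw => ?_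
  rw [← num_eq_of_info_eq_of_adj hu hw]
  refine and_congr_right fun _ => and_congr_right fun _ => forall_congr' fun e => ?_
  rw [← adj_iff_of_info_eq hv]
  exact imp_congr_right fun he => by rw [num_eq_of_info_eq_of_adj hv he]

open Classical in
theorem queryable_consistent (l : List (Fin n)) : Queryable (l.length * (2 * d + 1))
    fun X : LabeledGraph n d => decide (X.Consistent l) := by
  refine (Queryable.listMap l fun v _ => queryable_info v).of_factors fun X Y h => ?_
  rw [List.map_inj_left] at h
  rw [decide_eq_decide]
  unfold Consistent
  exact forall_congr' fun u => imp_congr_right fun hu => forall_congr' fun v =>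
    imp_congr_right fun hv => not_congr (seesViolation_iff_of_info_eq (h u hu) (h v hv))

/-- The walk from `v` finds no contradiction. -/
def Passes (X : LabeledGraph n d) (k : ℕ) (v : Fin n) : Prop :=
  ∃ l, X.walk k none v = some l ∧ X.Consistent l

open Classical in
theorem queryable_passes (k : ℕ) (v : Fin n) :
    Queryable (k * stepCost d + (k + 1) * (2 * d + 1))
      fun X : LabeledGraph n d => decide (X.Passes k v) := by
  have h := (queryable_walk (d := d) k none v).bind (g := fun a X => match a with
    | none => false
    | some l => decide (X.Consistent l)) (k' := (k + 1) * (2 * d + 1)) fun X => by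
      cases hl : X.walk k none v with
      | none => exact (Queryable.pure _).mono (Nat.zero_le _)
      | some l =>
        exact (queryable_consistent l).mono
          (Nat.mul_le_mul_right _ (X.length_walk_le _ _ _ _ hl))
  convert h using 2 with X
  unfold Passes
  cases X.walk k none v <;> simp

end LabeledGraph

end walk

/-! ### Inputs without violations pass every test. -/

namespace LabeledGraph

variable {n d : ℕ} {X : LabeledGraph n d}

/-- The graph on the labels. -/
def labelGraph (X : LabeledGraph n d) : SimpleGraph (Fin n) := X.graph.comap X.num.symm

theorem SeesViolation.exists_violates {u v : Fin n} (h : X.SeesViolation u v) :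
    ∃ a c, Violates X.labelGraph a (X.num v) c := by
  obtain ⟨w, hw, h1, h2, h3⟩ := h
  refine ⟨_, _, h1, h2, ?_, fun e he hev => ?_⟩
  · rcases le_total (X.num u) (X.num w) with h | h
    · simpa [labelGraph, h] using hw
    · simpa [labelGraph, h] using hw.symm
  · have he' : X.graph.Adj (X.num.symm e) v := by simpa [labelGraph] using he
    simpa using h3 _ he'.symm (by simpa using hev)

theorem seesViolation_left {a b c : Fin n} (h : Violates X.labelGraph a b c) :
    X.SeesViolation (X.num.symm a) (X.num.symm b) := by
  obtain ⟨hab, hbc, hac, hb⟩ := h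
  have hle : a ≤ c := (hab.trans hbc).le
  refine ⟨X.num.symm c, hac, by simpa [hle], by simpa [hle], fun e he heb => ?_⟩
  simp only [Equiv.apply_symm_apply, min_eq_left hle] at heb ⊢
  refine hb _ ?_ heb
  simpa [labelGraph] using he.symm

theorem seesViolation_right {a b c : Fin n} (h : Violates X.labelGraph a b c) :
    X.SeesViolation (X.num.symm c) (X.num.symm b) := by
  obtain ⟨hab, hbc, hac, hb⟩ := h
  have hle : a ≤ c := (hab.trans hbc).le
  refine ⟨X.num.symm a, hac.symm, by simpa [hle], by simpa [hle], fun e he heb => ?_⟩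
  simp only [Equiv.apply_symm_apply, min_eq_right hle] at heb ⊢
  refine hb _ ?_ heb
  simpa [labelGraph] using he.symm

theorem parent_eq_some {y q : Fin n} : X.parent y = some q ↔
    (X.graph.Adj y q ∧ X.num q < X.num y) ∧
      ∀ u, X.graph.Adj y u ∧ X.num u < X.num y → X.num u ≤ X.num q :=
  lastOf_eq_some

theorem parent_lt {y q : Fin n} (h : X.parent y = some q) : X.num q < X.num y :=
  (parent_eq_some.1 h).1.2

theorem adj_of_parent {y q : Fin n} (h : X.parent y = some q) : X.graph.Adj q y :=
  (parent_eq_some.1 h).1.1.symm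

theorem exists_parent {v u : Fin n} (h : X.graph.Adj v u) (hlt : X.num u < X.num v) :
    ∃ q, X.parent v = some q ∧ X.num u ≤ X.num q := by
  cases hq : X.parent v with
  | none => exact absurd ⟨h, hlt⟩ (lastOf_eq_none.1 hq u)
  | some q => exact ⟨q, rfl, (parent_eq_some.1 hq).2 u ⟨h, hlt⟩⟩

/-- The four-point condition in terms of parents; this is the form in which the walk uses it. -/
theorem exists_parent_of_jump (hX : ∀ a b c, ¬ Violates X.labelGraph a b c) {a b c : Fin n}
    (hab : X.num a < X.num b) (hbc : X.num b < X.num c) (hac : X.graph.Adj a c) :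
    ∃ q, X.parent b = some q ∧ X.num a ≤ X.num q := by
  by_contra hq
  refine hX (X.num a) (X.num b) (X.num c) ⟨hab, hbc, by simpa [labelGraph], fun e he heb => ?_⟩
  by_contra hae
  have he' : X.graph.Adj b (X.num.symm e) := by simpa [labelGraph] using he.symm
  obtain ⟨q, hq1, hq2⟩ := exists_parent he' (by simpa using heb)
  exact hq ⟨q, hq1, (not_lt.1 hae).trans (by simpa using hq2)⟩

theorem lastChild_eq_some {q w : Fin n} : X.lastChild q = some w ↔
    (X.graph.Adj q w ∧ X.parent w = some q) ∧
      ∀ u, X.graph.Adj q u ∧ X.parent u = some q → X.num u ≤ X.num w :=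
  lastOf_eq_some

theorem prevSibling_eq_some {q y z : Fin n} : X.prevSibling q y = some z ↔
    ((X.graph.Adj q z ∧ X.parent z = some q) ∧ X.num z < X.num y) ∧
      ∀ u, (X.graph.Adj q u ∧ X.parent u = some q) ∧ X.num u < X.num y → X.num u ≤ X.num z :=
  lastOf_eq_some

/-- If `z` is a child of `q`, then a later vertex whose parent comes after `q` has a parent that is
not smaller than `z`. -/
theorem le_parent_of_lt_parent (hX : ∀ a b c, ¬ Violates X.labelGraph a b c) {q z b p : Fin n}
    (hz : X.parent z = some q) (hb : X.parent b = some p) (hzb : X.num z < X.num b)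
    (hqp : X.num q < X.num p) : X.num z ≤ X.num p := by
  by_contra h
  -- Otherwise the edge `p b` jumps over `z`, so the parent `q` of `z` is at least `p`.
  obtain ⟨q', hq', hle⟩ := exists_parent_of_jump hX (not_le.1 h) hzb (adj_of_parent hb)
  rw [hz] at hq'
  cases hq'
  exact absurd hqp (not_lt.2 hle)

/-- The walk succeeds if there is no violation. -/
theorem isSome_walk (hX : ∀ a b c, ¬ Violates X.labelGraph a b c) (k : ℕ) :
    -- Invariant of the descent: everything between `v` and `y` has its parent at or after `v`,
    -- while `y` itself, if it has a parent, hangs below a vertex before `v`.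
    (∀ v, (X.walk k none v).isSome) ∧ ∀ y v, X.num v < X.num y →
      (∀ b, X.num v < X.num b → X.num b < X.num y →
        ∃ q, X.parent b = some q ∧ X.num v ≤ X.num q) →
      (∀ q, X.parent y = some q → X.num q < X.num v) → (X.walk k (some y) v).isSome := by
  induction k with
  | zero => exact ⟨fun v => rfl, fun y v _ _ _ => rfl⟩
  | succ k ih =>
    constructor
    · intro v
      rw [walk]
      split
      · rfl
      · rename_i q hq
        have hqv := parent_lt hq
        split_ifs with h1
        · rw [Option.isSome_map]
          exact ih.1 q
        · split
          · rename_i hz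
            have hlt : (X.num q).val + 1 < X.num v := by
              have := Fin.lt_def.1 hqv
              omega
            -- The edge `q v` jumps over the successor `b` of `q`. The parent of `b` is then at
            -- least `q`, hence `q` itself, so `b` is an earlier sibling of `v`.
            let b : Fin n := X.num.symm ⟨(X.num q).val + 1, by omega⟩
            have hb : (X.num b).val = (X.num q).val + 1 := by simp [b]
            obtain ⟨p, hp, hle⟩ := exists_parent_of_jump hX (a := q) (b := b) (c := v)
              (Fin.lt_def.2 (by omega)) (Fin.lt_def.2 (by omega)) (adj_of_parent hq)
            have hpq : p = q := by
              have := Fin.lt_def.1 (parent_lt hp)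
              exact X.num.injective (le_antisymm (Fin.le_def.2 (by omega)) hle)
            subst hpq
            exact absurd ⟨⟨adj_of_parent hp, hp⟩, Fin.lt_def.2 (by omega)⟩
              (lastOf_eq_none.1 hz b)
          · rename_i z hz
            obtain ⟨⟨⟨hz1, hz2⟩, hz3⟩, hz4⟩ := prevSibling_eq_some.1 hz
            rw [Option.isSome_map]
            refine ih.2 v z hz3 (fun b hzb hbv => ?_) fun p hp => ?_
            · obtain ⟨p, hp, hle⟩ := exists_parent_of_jump hX ((parent_lt hz2).trans hzb) hbv
                (adj_of_parent hq)
              refine ⟨p, hp, le_parent_of_lt_parent hX hz2 hp hzb (lt_of_le_of_ne hle fun h => ?_)⟩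
              obtain rfl := X.num.injective h
              exact absurd hzb (not_lt.2 (hz4 b ⟨⟨adj_of_parent hp, hp⟩, hbv⟩))
            · rw [hq] at hp
              cases hp
              exact parent_lt hz2
    · intro y v hvy hb hy
      rw [walk]
      split
      · rename_i w hw
        obtain ⟨⟨hw1, hw2⟩, hw3⟩ := lastChild_eq_some.1 hw
        -- If `w` came after `y`, then the edge `v w` would jump over `y` and push its parent up to
        -- `v` or beyond.
        have hwy : X.num w < X.num y := by
          rcases lt_trichotomy (X.num w) (X.num y) with h | h | h
          · exact h
          · obtain rfl := X.num.injective h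
            exact absurd (hy _ hw2) (lt_irrefl _)
          · obtain ⟨q, hq, hle⟩ := exists_parent_of_jump hX hvy h hw1
            exact absurd (hy q hq) (not_lt.2 hle)
        refine ih.2 y w hwy (fun b hwb hby => ?_) fun q hq => (hy q hq).trans (parent_lt hw2)
        obtain ⟨p, hp, hle⟩ := hb b ((parent_lt hw2).trans hwb) hby
        refine ⟨p, hp, le_parent_of_lt_parent hX hw2 hp hwb (lt_of_le_of_ne hle fun h => ?_)⟩
        obtain rfl := X.num.injective h
        exact absurd hwb (not_lt.2 (hw3 b ⟨adj_of_parent hp, hp⟩))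
      · rename_i hw
        rw [if_pos]
        · exact ih.1 v
        · by_contra h1
          have hlt : (X.num v).val + 1 < X.num y := by
            have := Fin.lt_def.1 hvy
            omega
          -- If `v` does not immediately precede `y`, then its successor must be a child of `v`, but
          -- `v` has no children.
          let b : Fin n := X.num.symm ⟨(X.num v).val + 1, by omega⟩
          have hbv : (X.num b).val = (X.num v).val + 1 := by simp [b]
          obtain ⟨p, hp, hle⟩ := hb b (Fin.lt_def.2 (by omega)) (Fin.lt_def.2 (by omega))
          have hpv : p = v := by
            have := Fin.lt_def.1 (parent_lt hp)
            exact X.num.injective (le_antisymm (Fin.le_def.2 (by omega)) hle)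
          subst hpv
          exact lastOf_eq_none.1 hw b ⟨adj_of_parent hp, hp⟩

theorem consistent_of_forall_not_violates (hX : ∀ a b c, ¬ Violates X.labelGraph a b c)
    (l : List (Fin n)) : X.Consistent l := by
  intro u _ v _ h
  obtain ⟨a, c, h⟩ := h.exists_violates
  exact hX _ _ _ h

theorem passes_of_forall_not_violates (hX : ∀ a b c, ¬ Violates X.labelGraph a b c) (k : ℕ)
    (v : Fin n) : X.Passes k v := by
  obtain ⟨l, hl⟩ := Option.isSome_iff_exists.1 ((isSome_walk hX k).1 v)
  exact ⟨l, hl, consistent_of_forall_not_violates hX l⟩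

/-! ### Amortized cost of the walk: descents and fuel. No assumption on violations is made here. -/

open Classical in
/-- The vertices on the path that descends from `v` to last children. -/
noncomputable def descent (X : LabeledGraph n d) (v : Fin n) : Finset (Fin n) :=
  Finset.univ.filter (Relation.ReflTransGen (fun v w => X.lastChild v = some w) v)

theorem lt_lastChild {v w : Fin n} (h : X.lastChild v = some w) : X.num v < X.num w :=
  parent_lt (lastChild_eq_some.1 h).1.2

theorem le_of_mem_descent {v w : Fin n} (h : w ∈ X.descent v) : X.num v ≤ X.num w := by
  simp only [descent, Finset.mem_filter, Finset.mem_univ, true_and] at h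
  induction h with
  | refl => exact le_rfl
  | tail _ h ih => exact ih.trans (lt_lastChild h).le

theorem card_descent_of_eq_some {v w : Fin n} (h : X.lastChild v = some w) :
    (X.descent v).card = (X.descent w).card + 1 := by
  classical
  have h1 : v ∉ X.descent w := fun hv => absurd (lt_lastChild h) (not_lt.2 (le_of_mem_descent hv))
  rw [← Finset.card_insert_of_notMem h1]
  congr 1
  ext x
  simp only [descent, Finset.mem_insert, Finset.mem_filter, Finset.mem_univ, true_and]
  rw [Relation.ReflTransGen.cases_head_iff]
  refine or_congr eq_comm ⟨?_, fun hx => ⟨w, h, hx⟩⟩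
  rintro ⟨w', hw', hx⟩
  rw [h] at hw'
  cases hw'
  exact hx

theorem card_descent_pos (v : Fin n) : 0 < (X.descent v).card :=
  Finset.card_pos.2 ⟨v, by simp [descent, Relation.ReflTransGen.refl]⟩

/-- The vertices visited by the walk in order to find the predecessor of `y`. -/
noncomputable def searchPath (X : LabeledGraph n d) (y : Fin n) : Finset (Fin n) :=
  match X.parent y with
  | none => ∅
  | some q =>
    if (X.num q).val + 1 = X.num y then ∅
    else
      match X.prevSibling q y with
      | none => ∅
      | some z => X.descent z

theorem exists_of_mem_searchPath {y v : Fin n} (h : v ∈ X.searchPath y) :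
    ∃ q z, X.parent y = some q ∧ X.prevSibling q y = some z ∧ v ∈ X.descent z := by
  unfold searchPath at h
  split at h
  · simp at h
  · rename_i q hq
    split_ifs at h
    · simp at h
    · split at h
      · simp at h
      · rename_i z hz
        exact ⟨q, z, hq, hz, h⟩

/-- Parents are unique, so two descents through a common vertex are nested. The start of a search
path has a later sibling, hence is not a last child and cannot be an inner vertex of the other
descent. So both paths start at the same `z`, and `y` and `y'` are both the next sibling of `z`. -/
theorem disjoint_searchPath {y y' : Fin n} (hy : y ≠ y') :
    Disjoint (X.searchPath y) (X.searchPath y') := by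
  rw [Finset.disjoint_left]
  intro v hv hv'
  obtain ⟨q, z, hq, hz, hvz⟩ := exists_of_mem_searchPath hv
  obtain ⟨q', z', hq', hz', hvz'⟩ := exists_of_mem_searchPath hv'
  simp only [descent, Finset.mem_filter, Finset.mem_univ, true_and] at hvz hvz'
  have key : ∀ {y q z z' : Fin n}, X.parent y = some q → X.prevSibling q y = some z →
      Relation.ReflTransGen (fun v w => X.lastChild v = some w) z' z → z' = z := by
    intro y q z z' hq hz h
    rcases Relation.ReflTransGen.cases_tail h with h | ⟨w, -, hw⟩
    · exact h.symm
    · exfalso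
      obtain ⟨⟨⟨hz1, hz2⟩, hz3⟩, hz4⟩ := prevSibling_eq_some.1 hz
      obtain ⟨⟨hw1, hw2⟩, hw3⟩ := lastChild_eq_some.1 hw
      rw [hz2] at hw2
      cases hw2
      exact absurd hz3 (not_lt.2 (hw3 y ⟨adj_of_parent hq, hq⟩))
  have hzz : z = z' := by
    have hun : Relator.RightUnique (Function.swap fun v w => X.lastChild v = some w) := by
      intro a b c hb hc
      have hb' := (lastChild_eq_some.1 hb).1.2
      have hc' := (lastChild_eq_some.1 hc).1.2
      rw [hb'] at hc'
      cases hc'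
      rfl
    rcases Relation.ReflTransGen.total_of_right_unique hun (Relation.reflTransGen_swap.2 hvz)
      (Relation.reflTransGen_swap.2 hvz') with h | h
    · exact (key hq hz (Relation.reflTransGen_swap.1 h)).symm
    · exact key hq' hz' (Relation.reflTransGen_swap.1 h)
  subst hzz
  obtain ⟨⟨⟨hz1, hz2⟩, hz3⟩, hz4⟩ := prevSibling_eq_some.1 hz
  obtain ⟨⟨⟨hz1', hz2'⟩, hz3'⟩, hz4'⟩ := prevSibling_eq_some.1 hz'
  rw [hz2] at hz2'
  cases hz2'
  rcases lt_trichotomy (X.num y) (X.num y') with h | h | h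
  · exact absurd hz3 (not_lt.2 (hz4' y ⟨⟨adj_of_parent hq, hq⟩, h⟩))
  · exact hy (X.num.injective h)
  · exact absurd hz3' (not_lt.2 (hz4 y' ⟨⟨adj_of_parent hq', hq'⟩, h⟩))

theorem sum_card_searchPath_le (X : LabeledGraph n d) :
    ∑ y, (X.searchPath y).card ≤ n := by
  classical
  rw [← Finset.card_biUnion fun y _ y' _ h => disjoint_searchPath h]
  exact (Finset.card_le_univ _).trans_eq (Fintype.card_fin n)

/-- The fuel needed by a walk through all labels up to that of `v`. -/
noncomputable def fuel (X : LabeledGraph n d) (v : Fin n) : ℕ :=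
  ∑ u with X.num u ≤ X.num v, (1 + (X.searchPath u).card)

theorem fuel_le (X : LabeledGraph n d) (v : Fin n) : X.fuel v ≤ 2 * n := by
  refine (Finset.sum_le_sum_of_subset (Finset.filter_subset _ _)).trans ?_
  rw [Finset.sum_add_distrib]
  have := X.sum_card_searchPath_le
  simp
  omega

theorem fuel_mono {u v : Fin n} (h : X.num u ≤ X.num v) : X.fuel u ≤ X.fuel v := by
  refine Finset.sum_le_sum_of_subset fun w hw => ?_
  simp only [Finset.mem_filter, Finset.mem_univ, true_and] at hw ⊢
  exact hw.trans h

theorem fuel_eq_of_succ {u v : Fin n} (h : (X.num u).val + 1 = X.num v) :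
    X.fuel v = X.fuel u + (1 + (X.searchPath v).card) := by
  classical
  unfold fuel
  have : (Finset.univ.filter fun w => X.num w ≤ X.num v) =
      insert v (Finset.univ.filter fun w => X.num w ≤ X.num u) := by
    ext w
    simp only [Finset.mem_filter, Finset.mem_univ, true_and, Finset.mem_insert]
    rw [← X.num.injective.eq_iff, Fin.ext_iff, Fin.le_def, Fin.le_def]
    omega
  rw [this, Finset.sum_insert, add_comm]
  simp only [Finset.mem_filter, Finset.mem_univ, true_and, Fin.le_def]
  omega

theorem mem_of_walk_eq_some {k : ℕ} {v : Fin n} {l : List (Fin n)}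
    (h : X.walk k none v = some l) : v ∈ l := by
  cases k with
  | zero =>
    simp only [walk, Option.some.injEq] at h
    subst h
    simp
  | succ k =>
    rw [walk] at h
    split at h
    · cases h; simp
    · split_ifs at h
      · simp only [Option.map_eq_some_iff] at h
        obtain ⟨l', -, rfl⟩ := h
        simp
      · split at h
        · cases h
        · simp only [Option.map_eq_some_iff] at h
          obtain ⟨l', -, rfl⟩ := h
          simp

/-- Each vertex of the descent costs one unit of fuel, the last one being paid when the walk returns
to the state `none`. As the walk did not fail, it ends at the predecessor of `y`. -/
theorem exists_walk_of_descent {y : Fin n} {l : List (Fin n)} : ∀ (k : ℕ) (v : Fin n),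
    X.walk k (some y) v = some l → (X.descent v).card ≤ k →
    ∃ u, (X.num u).val + 1 = X.num y ∧ X.walk (k - (X.descent v).card) none u = some l := by
  intro k
  induction k with
  | zero =>
    intro v _ hk
    have := card_descent_pos (X := X) v
    omega
  | succ k ih =>
    intro v h hk
    rw [walk] at h
    split at h
    · rename_i w hw
      rw [card_descent_of_eq_some hw] at hk ⊢
      obtain ⟨u, hu1, hu2⟩ := ih w h (by omega)
      exact ⟨u, hu1, by rwa [Nat.add_sub_add_right]⟩
    · rename_i hw
      have h1 : X.descent v = {v} := by
        ext x
        simp only [descent, Finset.mem_filter, Finset.mem_univ, true_and, Finset.mem_singleton]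
        rw [Relation.ReflTransGen.cases_head_iff]
        simp [hw, eq_comm]
      split_ifs at h with h2
      exact ⟨v, h2, by simpa [h1] using h⟩

/-- The walk visits all vertices for which the fuel suffices, up to the first vertex without
parent. -/
theorem mem_of_walk {x : Fin n} : ∀ (m k : ℕ) (v : Fin n) (l : List (Fin n)),
    X.walk k none v = some l → (X.num x).val + m = X.num v → X.fuel v ≤ X.fuel x + k →
    (∀ r, X.num x < X.num r → X.num r ≤ X.num v → X.parent r ≠ none) → x ∈ l := by
  intro m
  induction m with
  | zero =>
    intro k v l h hm _ _
    obtain rfl : x = v := X.num.injective (Fin.ext hm)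
    exact mem_of_walk_eq_some h
  | succ m ih =>
    intro k v l h hm hk hr
    have hxv : X.num x < X.num v := Fin.lt_def.2 (by omega)
    let u : Fin n := X.num.symm ⟨(X.num v).val - 1, by omega⟩
    have hu : (X.num u).val + 1 = X.num v := by simp [u]; omega
    have hfu := fuel_eq_of_succ hu
    have hxu : X.fuel x ≤ X.fuel u := fuel_mono (Fin.le_def.2 (by omega))
    have huniq : ∀ w, (X.num w).val + 1 = X.num v → w = u :=
      fun w hw => X.num.injective (Fin.ext (by omega))
    have hru : ∀ r, X.num x < X.num r → X.num r ≤ X.num u → X.parent r ≠ none :=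
      fun r h1 h2 => hr r h1 (h2.trans (Fin.le_def.2 (by omega)))
    obtain ⟨k, rfl⟩ : ∃ j, k = j + 1 := ⟨k - 1, by omega⟩
    rw [walk] at h
    split at h
    · rename_i hq
      exact absurd hq (hr v hxv le_rfl)
    · rename_i q hq
      split_ifs at h with h1
      · simp only [Option.map_eq_some_iff] at h
        obtain ⟨l', hl', rfl⟩ := h
        obtain rfl := huniq q h1
        exact List.mem_cons_of_mem _ (ih k _ l' hl' (by omega) (by omega) hru)
      · split at h
        · cases h
        · rename_i z hz
          simp only [Option.map_eq_some_iff] at h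
          obtain ⟨l', hl', rfl⟩ := h
          have hs : X.searchPath v = X.descent z := by
            unfold searchPath
            simp [hq, h1, hz]
          rw [hs] at hfu
          obtain ⟨w, hw1, hw2⟩ := exists_walk_of_descent k z hl' (by omega)
          obtain rfl := huniq w hw1
          exact List.mem_cons_of_mem _ (ih _ _ l' hw2 (by omega) (by omega) hru)

/-- The walk from `v` can miss `x` only by stopping early at a vertex without parent. The edge `u v`
jumps over such a vertex, so the walk would have seen a violation. -/
theorem exists_visited {k : ℕ} {v x u : Fin n} (hv : X.Passes k v) (hxv : X.num x < X.num v)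
    (hk : X.fuel v ≤ X.fuel x + k) (hu : X.graph.Adj v u) (hux : X.num u < X.num x) :
    ∃ l, X.Consistent l ∧ v ∈ l ∧ x ∈ l := by
  classical
  obtain ⟨l, hl, hc⟩ := hv
  have hvl := mem_of_walk_eq_some hl
  have hroots : ∀ r, X.num x < X.num r → X.num r ≤ X.num v → X.parent r ≠ none := by
    by_contra hno
    push Not at hno
    obtain ⟨r₀, h1, h2, h3⟩ := hno
    -- The largest parentless vertex in the range is the first that the walk meets, so it is
    -- certainly visited.
    obtain ⟨r, hr, hmax⟩ := Finset.exists_max_image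
      (Finset.univ.filter fun r => X.num x < X.num r ∧ X.num r ≤ X.num v ∧ X.parent r = none) X.num
      ⟨r₀, by simp [h1, h2, h3]⟩
    simp only [Finset.mem_filter, Finset.mem_univ, true_and] at hr hmax
    have hrl : r ∈ l := by
      refine mem_of_walk ((X.num v).val - (X.num r).val) k v l hl ?_
        (hk.trans (Nat.add_le_add_right (fuel_mono hr.1.le) k)) fun s hrs hsv hs => ?_
      · have := Fin.le_def.1 hr.2.1
        omega
      · exact absurd hrs (not_lt.2 (hmax s ⟨hr.1.trans hrs, hsv, hs⟩))
    have hne : X.num r ≠ X.num v := by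
      intro h
      obtain rfl := X.num.injective h
      exact lastOf_eq_none.1 hr.2.2 u ⟨hu, hux.trans hxv⟩
    have huv : X.num u ≤ X.num v := (hux.trans hxv).le
    refine hc v hvl r hrl ⟨u, hu, ?_, ?_, fun e he her => absurd ⟨he, her⟩
      (lastOf_eq_none.1 hr.2.2 e)⟩
    · rw [min_eq_right huv]
      exact hux.trans hr.1
    · rw [max_eq_left huv]
      exact lt_of_le_of_ne hr.2.1 hne
  refine ⟨l, hc, hvl, mem_of_walk ((X.num v).val - (X.num x).val) k v l hl ?_ hk hroots⟩
  have := Fin.lt_def.1 hxv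
  omega

/-- A violation whose upper end passes the test cannot have its middle vertex in the range of the
walk. -/
theorem not_violates_of_passes_upper {k : ℕ} {a b c : Fin n} (hc : X.Passes k (X.num.symm c))
    (hk : X.fuel (X.num.symm c) ≤ X.fuel (X.num.symm b) + k) : ¬ Violates X.labelGraph a b c := by
  intro h
  obtain ⟨l, hl, h1, h2⟩ := exists_visited (x := X.num.symm b) (u := X.num.symm a) hc
    (by simpa using h.2.1) hk h.2.2.1.symm (by simpa using h.1)
  exact hl _ h1 _ h2 (seesViolation_right h)

/-- A violation whose middle vertex passes the test and has a smaller neighbor cannot have its lower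
end in the range of the walk. -/
theorem not_violates_of_passes_middle {k : ℕ} {a b c e : Fin n} (hb : X.Passes k (X.num.symm b))
    (hk : X.fuel (X.num.symm b) ≤ X.fuel (X.num.symm a) + k) (he : X.labelGraph.Adj e b)
    (hea : e < a) : ¬ Violates X.labelGraph a b c := by
  intro h
  obtain ⟨l, hl, h1, h2⟩ := exists_visited (x := X.num.symm a) (u := X.num.symm e) hb
    (by simpa using h.1) hk he.symm (by simpa using hea)
  exact hl _ h2 _ h1 (seesViolation_left h)

end LabeledGraph

/-! ### A second moment bound for two independent samples. -/

section birthday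

theorem sum_apply_eq {ι V : Type} [Fintype ι] [DecidableEq ι] [Fintype V] (i : ι) (F : V → ℝ) :
    Fintype.card V * ∑ f : ι → V, F (f i) = Fintype.card V ^ Fintype.card ι * ∑ u, F u := by
  have h1 : ∑ f : ι → V, F (f i) = Fintype.card ({j // j ≠ i} → V) * ∑ u, F u := by
    rw [← (Equiv.funSplitAt i V).symm.sum_comp, Fintype.sum_prod_type, Finset.mul_sum]
    refine Finset.sum_congr rfl fun u _ => ?_
    simp [Equiv.funSplitAt, Equiv.piSplitAt]
  have h2 : (Fintype.card V : ℝ) ^ Fintype.card ι =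
      Fintype.card V * Fintype.card ({j // j ≠ i} → V) := by
    rw [← Nat.cast_pow, ← Nat.cast_mul, ← Fintype.card_prod, ← Fintype.card_fun]
    exact congrArg _ (Fintype.card_congr (Equiv.funSplitAt i V))
  rw [h1, h2]
  ring

/-- Independence of two coordinates of a uniformly random function, with denominators cleared. -/
theorem sum_apply_apply_eq {ι V : Type} [Fintype ι] [DecidableEq ι] [Fintype V] {i i' : ι}
    (hi : i' ≠ i) (F : V → V → ℝ) :
    (Fintype.card V : ℝ) ^ 2 * ∑ f : ι → V, F (f i) (f i') =
      Fintype.card V ^ Fintype.card ι * ∑ u, ∑ v, F u v := by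
  have h1 : ∑ f : ι → V, F (f i) (f i') = ∑ u, ∑ g : {j // j ≠ i} → V, F u (g ⟨i', hi⟩) := by
    rw [← (Equiv.funSplitAt i V).symm.sum_comp, Fintype.sum_prod_type]
    refine Finset.sum_congr rfl fun u _ => Finset.sum_congr rfl fun g _ => ?_
    simp [Equiv.funSplitAt, Equiv.piSplitAt, hi]
  have h2 : (Fintype.card V : ℝ) ^ Fintype.card ι =
      Fintype.card V * Fintype.card V ^ Fintype.card {j // j ≠ i} := by
    rw [← Nat.cast_pow, ← Nat.cast_pow, ← Nat.cast_mul, ← Fintype.card_fun, ← Fintype.card_fun,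
      ← Fintype.card_prod]
    exact congrArg _ (Fintype.card_congr (Equiv.funSplitAt i V))
  rw [h1, h2, Finset.mul_sum, Finset.mul_sum]
  refine Finset.sum_congr rfl fun u _ => ?_
  have := sum_apply_eq (⟨i', hi⟩ : {j // j ≠ i}) (F u)
  linear_combination (Fintype.card V : ℝ) * this

variable {V : Type} [Fintype V]

/-- The second moment of the number of hits of two independent random samples. -/
theorem sum_sum_mul_le [Nonempty V] {s : ℕ} (ρ : V → V → ℝ) (hρ : ∀ u v, 0 ≤ ρ u v)
    (hρ1 : ∀ u v, ρ u v ≤ 1) {w : ℝ} (hrow : ∀ u, ∑ v, ρ u v ≤ w) (hcol : ∀ v, ∑ u, ρ u v ≤ w)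
    (i i' j j' : Fin s) :
    ∑ f : Fin s → V, ∑ g : Fin s → V, ρ (f i) (g j) * ρ (f i') (g j') ≤
      ((Fintype.card V : ℝ) ^ s) ^ 2 *
        ((if i = i' ∧ j = j' then (∑ u, ∑ v, ρ u v) / (Fintype.card V : ℝ) ^ 2 else 0) +
        (if i = i' then w * (∑ u, ∑ v, ρ u v) / (Fintype.card V : ℝ) ^ 3 else 0) +
        (if j = j' then w * (∑ u, ∑ v, ρ u v) / (Fintype.card V : ℝ) ^ 3 else 0) +
        (∑ u, ∑ v, ρ u v) ^ 2 / (Fintype.card V : ℝ) ^ 4) := by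
  set N : ℝ := ((Fintype.card V : ℕ) : ℝ) with hN
  set E : ℝ := ∑ u, ∑ v, ρ u v with hE
  have hNpos : 0 < N := by
    rw [hN]
    exact_mod_cast Fintype.card_pos
  have hE0 : 0 ≤ E := Finset.sum_nonneg fun u _ => Finset.sum_nonneg fun v _ => hρ u v
  have hw : 0 ≤ w := by
    obtain ⟨u⟩ := ‹Nonempty V›
    exact (Finset.sum_nonneg fun v _ => hρ u v).trans (hrow u)
  have hE' : E = ∑ v, ∑ u, ρ u v := Finset.sum_comm
  have one : ∀ (i : Fin s) (F : V → ℝ), ∑ f : Fin s → V, F (f i) = N ^ s * (∑ u, F u) / N := by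
    intro i F
    have := sum_apply_eq i F
    rw [Fintype.card_fin] at this
    rw [eq_div_iff hNpos.ne']
    linarith
  have two : ∀ (i i' : Fin s) (F : V → V → ℝ), i ≠ i' →
      ∑ f : Fin s → V, F (f i) (f i') = N ^ s * (∑ u, ∑ v, F u v) / N ^ 2 := by
    intro i i' F h
    have := sum_apply_apply_eq h.symm F
    rw [Fintype.card_fin] at this
    rw [eq_div_iff (by positivity)]
    linarith
  have hsq : ∀ u, (∑ v, ρ u v) * (∑ v, ρ u v) ≤ w * ∑ v, ρ u v := fun u =>
    mul_le_mul_of_nonneg_right (hrow u) (Finset.sum_nonneg fun v _ => hρ u v)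
  have hsq' : ∀ v, (∑ u, ρ u v) * (∑ u, ρ u v) ≤ w * ∑ u, ρ u v := fun v =>
    mul_le_mul_of_nonneg_right (hcol v) (Finset.sum_nonneg fun u _ => hρ u v)
  have hA : 0 ≤ E / N ^ 2 := by positivity
  have hB : 0 ≤ w * E / N ^ 3 := by positivity
  have hC : 0 ≤ E ^ 2 / N ^ 4 := by positivity
  -- The four cases correspond to the four summands. One coincidence leaves a sum of squared column
  -- or row sums, which the degree bound `w` controls; no coincidence means independence.
  by_cases hj : j = j'
  · subst hj
    by_cases hi : i = i'
    · subst hi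
      have h1 : ∑ f : Fin s → V, ∑ g : Fin s → V, ρ (f i) (g j) * ρ (f i) (g j) ≤
          ∑ f : Fin s → V, ∑ g : Fin s → V, ρ (f i) (g j) :=
        Finset.sum_le_sum fun f _ => Finset.sum_le_sum fun g _ =>
          mul_le_of_le_one_left (hρ _ _) (hρ1 _ _)
      have h2 : ∑ f : Fin s → V, ∑ g : Fin s → V, ρ (f i) (g j) = (N ^ s) ^ 2 * (E / N ^ 2) := by
        rw [Finset.sum_congr rfl fun f _ => one j (ρ (f i))]
        rw [one i fun u => N ^ s * (∑ v, ρ u v) / N, ← Finset.sum_div, ← Finset.mul_sum, ← hE]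
        field_simp
      refine (h1.trans_eq h2).trans (mul_le_mul_of_nonneg_left ?_ (by positivity))
      simp only [and_self, if_true]
      linarith
    · have h2 : ∑ f : Fin s → V, ∑ g : Fin s → V, ρ (f i) (g j) * ρ (f i') (g j) =
          (N ^ s) ^ 2 * ((∑ v, (∑ u, ρ u v) * ∑ u, ρ u v) / N ^ 3) := by
        rw [Finset.sum_congr rfl fun f _ => one j fun v => ρ (f i) v * ρ (f i') v]
        rw [two i i' (fun u u' => N ^ s * (∑ v, ρ u v * ρ u' v) / N) hi]
        have : ∑ u, ∑ u', N ^ s * (∑ v, ρ u v * ρ u' v) / N =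
            N ^ s / N * ∑ v, (∑ u, ρ u v) * ∑ u, ρ u v := by
          simp only [Finset.sum_mul_sum]
          simp only [Finset.mul_sum, Finset.sum_div]
          rw [Finset.sum_congr rfl fun u _ => Finset.sum_comm, Finset.sum_comm]
          refine Finset.sum_congr rfl fun v _ => Finset.sum_congr rfl fun u _ =>
            Finset.sum_congr rfl fun u' _ => by ring
        rw [this]
        field_simp
      rw [h2]
      refine mul_le_mul_of_nonneg_left ?_ (by positivity)
      have h3 : (∑ v, (∑ u, ρ u v) * ∑ u, ρ u v) / N ^ 3 ≤ w * E / N ^ 3 := by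
        rw [hE', Finset.mul_sum]
        exact div_le_div_of_nonneg_right (Finset.sum_le_sum fun v _ => hsq' v) (by positivity)
      simp only [hi, false_and, if_false, if_true]
      linarith
  · by_cases hi : i = i'
    · subst hi
      have h2 : ∑ f : Fin s → V, ∑ g : Fin s → V, ρ (f i) (g j) * ρ (f i) (g j') =
          (N ^ s) ^ 2 * ((∑ u, (∑ v, ρ u v) * ∑ v, ρ u v) / N ^ 3) := by
        rw [Finset.sum_congr rfl fun f _ => two j j' (fun v v' => ρ (f i) v * ρ (f i) v') hj]
        rw [one i fun u => N ^ s * (∑ v, ∑ v', ρ u v * ρ u v') / N ^ 2, ← Finset.sum_div,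
          ← Finset.mul_sum]
        simp only [Finset.sum_mul_sum]
        field_simp
      rw [h2]
      refine mul_le_mul_of_nonneg_left ?_ (by positivity)
      have h3 : (∑ u, (∑ v, ρ u v) * ∑ v, ρ u v) / N ^ 3 ≤ w * E / N ^ 3 := by
        rw [hE, Finset.mul_sum]
        exact div_le_div_of_nonneg_right (Finset.sum_le_sum fun u _ => hsq u) (by positivity)
      simp only [hj, and_false, if_false, if_true]
      linarith
    · have h2 : ∑ f : Fin s → V, ∑ g : Fin s → V, ρ (f i) (g j) * ρ (f i') (g j') =
          (N ^ s) ^ 2 * (E ^ 2 / N ^ 4) := by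
        rw [Finset.sum_congr rfl fun f _ => two j j' (fun v v' => ρ (f i) v * ρ (f i') v') hj]
        rw [two i i' (fun u u' => N ^ s * (∑ v, ∑ v', ρ u v * ρ u' v') / N ^ 2) hi]
        have : ∑ u, ∑ u', N ^ s * (∑ v, ∑ v', ρ u v * ρ u' v') / N ^ 2 = N ^ s / N ^ 2 * E ^ 2 := by
          rw [sq E, hE, Finset.sum_mul_sum, Finset.mul_sum]
          refine Finset.sum_congr rfl fun u _ => ?_
          rw [Finset.mul_sum]
          refine Finset.sum_congr rfl fun u' _ => ?_
          rw [Finset.sum_mul_sum]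
          ring
        rw [this]
        field_simp
      rw [h2]
      refine mul_le_mul_of_nonneg_left ?_ (by positivity)
      simp only [hi, hj, false_and, if_false]
      linarith

open Classical in
/-- Two independent random samples hit a dense bipartite relation of bounded degree. -/
theorem card_hit_ge [Nonempty V] {s : ℕ} (r : V → V → Prop) {w : ℝ}
    (hrow : ∀ u, ((Finset.univ.filter (r u)).card : ℝ) ≤ w)
    (hcol : ∀ v, ((Finset.univ.filter fun u => r u v).card : ℝ) ≤ w)
    (hE : ((Finset.univ.filter fun p : V × V => r p.1 p.2).card : ℝ) = w ^ 2 / 2)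
    (hs : 20 * Fintype.card V ≤ s * w) :
    2 / 3 * (Fintype.card ((Fin s → V) × (Fin s → V)) : ℝ) ≤
      (Finset.univ.filter fun p : (Fin s → V) × (Fin s → V) => ∃ i j, r (p.1 i) (p.2 j)).card := by
  set N : ℝ := ((Fintype.card V : ℕ) : ℝ) with hN
  have hNpos : 0 < N := by
    rw [hN]
    exact_mod_cast Fintype.card_pos
  set ρ : V → V → ℝ := fun u v => if r u v then 1 else 0 with hρ
  have hρ0 : ∀ u v, 0 ≤ ρ u v := fun u v => by simp only [hρ]; split_ifs <;> norm_num
  have hρ1 : ∀ u v, ρ u v ≤ 1 := fun u v => by simp only [hρ]; split_ifs <;> norm_num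
  have hEρ : ∑ u, ∑ v, ρ u v = w ^ 2 / 2 := by
    rw [← hE, ← Fintype.sum_prod_type']
    simp [hρ]
  set Z : (Fin s → V) × (Fin s → V) → ℝ := fun p => ∑ i, ∑ j, ρ (p.1 i) (p.2 j) with hZ
  set H := Finset.univ.filter fun p : (Fin s → V) × (Fin s → V) => ∃ i j, r (p.1 i) (p.2 j) with hH
  have hsumZ : ∑ p, Z p = (N ^ s) ^ 2 * ((s : ℝ) ^ 2 * (w ^ 2 / 2) / N ^ 2) := by
    have hij : ∀ i j : Fin s, ∑ p : (Fin s → V) × (Fin s → V), ρ (p.1 i) (p.2 j) =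
        (N ^ s) ^ 2 * ((w ^ 2 / 2) / N ^ 2) := by
      intro i j
      have one : ∀ (i : Fin s) (F : V → ℝ), ∑ f : Fin s → V, F (f i) = N ^ s * (∑ u, F u) / N := by
        intro i F
        have := sum_apply_eq i F
        rw [Fintype.card_fin] at this
        rw [eq_div_iff hNpos.ne']
        linarith
      rw [Fintype.sum_prod_type]
      rw [Finset.sum_congr rfl fun f _ => one j (ρ (f i))]
      rw [one i fun u => N ^ s * (∑ v, ρ u v) / N, ← Finset.sum_div, ← Finset.mul_sum, hEρ]
      field_simp
    rw [hZ, Finset.sum_comm]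
    rw [Finset.sum_congr rfl fun i _ => Finset.sum_comm]
    simp only [hij]
    simp
    ring
  have hsumZ2 : ∑ p, Z p ^ 2 ≤ (N ^ s) ^ 2 * ((s : ℝ) ^ 2 * (w ^ 2 / 2) / N ^ 2 +
      (s : ℝ) ^ 3 * (w * (w ^ 2 / 2)) / N ^ 3 + (s : ℝ) ^ 3 * (w * (w ^ 2 / 2)) / N ^ 3 +
      (s : ℝ) ^ 4 * (w ^ 2 / 2) ^ 2 / N ^ 4) := by
    have h1 : ∑ p, Z p ^ 2 = ∑ i, ∑ i', ∑ j, ∑ j', ∑ f : Fin s → V, ∑ g : Fin s → V,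
        ρ (f i) (g j) * ρ (f i') (g j') := by
      have h2 : ∀ p, Z p ^ 2 = ∑ i, ∑ i', ∑ j, ∑ j', ρ (p.1 i) (p.2 j) * ρ (p.1 i') (p.2 j') := by
        intro p
        rw [sq, hZ, Finset.sum_mul_sum]
        simp only [Finset.sum_mul_sum]
      rw [Finset.sum_congr rfl fun p _ => h2 p, Finset.sum_comm]
      refine Finset.sum_congr rfl fun i _ => ?_
      rw [Finset.sum_comm]
      refine Finset.sum_congr rfl fun i' _ => ?_
      rw [Finset.sum_comm]
      refine Finset.sum_congr rfl fun j _ => ?_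
      rw [Finset.sum_comm]
      exact Finset.sum_congr rfl fun j' _ => Fintype.sum_prod_type _
    rw [h1]
    have h3 : ∀ i i' j j' : Fin s, _ := sum_sum_mul_le (s := s) ρ hρ0 hρ1 (w := w)
      (fun u => by simpa [hρ] using hrow u) (fun v => by simpa [hρ] using hcol v)
    refine (Finset.sum_le_sum fun i _ => Finset.sum_le_sum fun i' _ => Finset.sum_le_sum fun j _ =>
      Finset.sum_le_sum fun j' _ => h3 i i' j j').trans_eq ?_
    rw [hEρ]
    simp only [← Finset.mul_sum, Finset.sum_add_distrib, ite_and, Finset.sum_ite_eq,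
      Finset.mem_univ, if_true, Finset.sum_const, Finset.card_univ, Fintype.card_fin, nsmul_eq_mul]
    congr 1
    simp
    ring
  -- Cauchy–Schwarz: the number of hits `Z` vanishes outside `H`.
  have hCS : (∑ p, Z p) ^ 2 ≤ H.card * ∑ p, Z p ^ 2 := by
    have h1 : ∑ p, Z p = ∑ p ∈ H, Z p := by
      refine (Finset.sum_subset (Finset.subset_univ _) fun p _ hp => ?_).symm
      refine Finset.sum_eq_zero fun i _ => Finset.sum_eq_zero fun j _ => ?_
      simp only [hH, Finset.mem_filter, Finset.mem_univ, true_and, not_exists] at hp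
      simp [hρ, hp i j]
    rw [h1]
    refine sq_sum_le_card_mul_sum_sq.trans (mul_le_mul_of_nonneg_left ?_ (by positivity))
    exact Finset.sum_le_sum_of_subset_of_nonneg (Finset.subset_univ _) fun p _ _ => sq_nonneg _
  have hcard : (Fintype.card ((Fin s → V) × (Fin s → V)) : ℝ) = (N ^ s) ^ 2 := by
    simp [sq, hN]
  rw [hcard]
  set y : ℝ := s * w / N with hy
  have hy20 : 20 ≤ y := by
    rw [hy, le_div_iff₀ hNpos]
    exact hs
  have e1 : (s : ℝ) ^ 2 * (w ^ 2 / 2) / N ^ 2 = y ^ 2 / 2 := by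
    rw [hy]; field_simp
  have e2 : (s : ℝ) ^ 3 * (w * (w ^ 2 / 2)) / N ^ 3 = y ^ 3 / 2 := by
    rw [hy]; field_simp
  have e3 : (s : ℝ) ^ 4 * (w ^ 2 / 2) ^ 2 / N ^ 4 = y ^ 4 / 4 := by
    rw [hy]; field_simp; norm_num
  rw [e1, e2, e3] at hsumZ2
  rw [e1] at hsumZ
  have hNs : 0 < (N ^ s) ^ 2 := by positivity
  have h5 : ((N ^ s) ^ 2 * (y ^ 2 / 2)) ^ 2 ≤
      H.card * ((N ^ s) ^ 2 * (y ^ 2 / 2 + y ^ 3 / 2 + y ^ 3 / 2 + y ^ 4 / 4)) := by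
    rw [← hsumZ]
    exact hCS.trans (mul_le_mul_of_nonneg_left hsumZ2 (by positivity))
  have h6 : (N ^ s) ^ 2 * (y ^ 4 / 4) ≤ H.card * (y ^ 2 / 2 + y ^ 3 + y ^ 4 / 4) := by
    refine le_of_mul_le_mul_left ?_ hNs
    linarith
  -- This amounts to `y² - 8y - 4 ≥ 0`, and (y - 20)(y + 12) = y² - 8y - 240.
  have h7 : 2 / 3 * (y ^ 2 / 2 + y ^ 3 + y ^ 4 / 4) ≤ y ^ 4 / 4 := by
    have : 0 ≤ y ^ 2 * ((y - 20) * (y + 12)) := by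
      have := sub_nonneg.2 hy20
      positivity
    nlinarith [sq_nonneg y]
  have h8 : 0 < y ^ 2 / 2 + y ^ 3 + y ^ 4 / 4 := by positivity
  refine le_of_mul_le_mul_right (le_trans ?_ h6) h8
  calc 2 / 3 * (N ^ s) ^ 2 * (y ^ 2 / 2 + y ^ 3 + y ^ 4 / 4)
      = (N ^ s) ^ 2 * (2 / 3 * (y ^ 2 / 2 + y ^ 3 + y ^ 4 / 4)) := by ring
    _ ≤ _ := mul_le_mul_of_nonneg_left h7 hNs.le

end birthday

/-! ### From a matching divided into blocks to a dense relation. -/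

/-- A maximal matching in a relation. -/
theorem exists_maximal_matching {V : Type} [Fintype V] (R : V → V → Prop) :
    ∃ M : Finset (V × V), (∀ p ∈ M, R p.1 p.2) ∧ Set.InjOn Prod.fst (M : Set (V × V)) ∧
      Set.InjOn Prod.snd (M : Set (V × V)) ∧
      ∀ a x, R a x → (∃ p ∈ M, p.1 = a) ∨ ∃ p ∈ M, p.2 = x := by
  classical
  obtain ⟨M, hM, hmax⟩ := Finset.exists_max_image
    (Finset.univ.filter fun M : Finset (V × V) => (∀ p ∈ M, R p.1 p.2) ∧
      Set.InjOn Prod.fst (M : Set (V × V)) ∧ Set.InjOn Prod.snd (M : Set (V × V)))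
    Finset.card ⟨∅, by simp⟩
  simp only [Finset.mem_filter, Finset.mem_univ, true_and] at hM hmax
  refine ⟨M, hM.1, hM.2.1, hM.2.2, fun a x h => ?_⟩
  by_contra hno
  push Not at hno
  have hnot : (a, x) ∉ M := fun h => hno.1 _ h rfl
  have := hmax (insert (a, x) M) ⟨?_, ?_, ?_⟩
  · rw [Finset.card_insert_of_notMem hnot] at this
    omega
  · intro p hp
    rcases Finset.mem_insert.1 hp with rfl | hp
    · exact h
    · exact hM.1 p hp
  · rw [Finset.coe_insert, Set.injOn_insert (by simpa using hnot)]
    refine ⟨hM.2.1, ?_⟩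
    rintro ⟨p, hp, hpa⟩
    exact hno.1 p hp hpa
  · rw [Finset.coe_insert, Set.injOn_insert (by simpa using hnot)]
    refine ⟨hM.2.2, ?_⟩
    rintro ⟨p, hp, hpa⟩
    exact hno.2 p hp hpa

open Classical in
/-- Two independent samples of the vertices contain, with high probability, the first vertex of a
pair of a matching and the second vertex of a later pair in the same block. -/
theorem card_hit_matching_ge {V : Type} [Fintype V] [Nonempty V] {s B : ℕ} (M : Finset (V × V))
    (hfst : Set.InjOn Prod.fst (M : Set (V × V))) (hsnd : Set.InjOn Prod.snd (M : Set (V × V)))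
    (blk rk : V → ℕ) (hB : 0 < B) (hblk : ∀ p ∈ M, blk p.2 < B)
    (hs : 20 * Fintype.card V * √B ≤ s * M.card) {r : V → V → Prop}
    (hr : ∀ p ∈ M, ∀ q ∈ M, blk p.2 = blk q.2 → rk p.2 ≤ rk q.2 → r p.1 q.2) :
    2 / 3 * (Fintype.card ((Fin s → V) × (Fin s → V)) : ℝ) ≤
      (Finset.univ.filter fun ω : (Fin s → V) × (Fin s → V) => ∃ i j, r (ω.1 i) (ω.2 j)).card := by
  set S := (M ×ˢ M).filter fun t => blk t.1.2 = blk t.2.2 with hS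
  set E := (M ×ˢ M).filter fun t => blk t.1.2 = blk t.2.2 ∧ rk t.1.2 ≤ rk t.2.2 with hE
  obtain ⟨r₀, hr₀⟩ : ∃ r₀ : V → V → Prop, ∀ u v, r₀ u v ↔ ∃ p ∈ M, ∃ q ∈ M,
    u = p.1 ∧ v = q.2 ∧ blk p.2 = blk q.2 ∧ rk p.2 ≤ rk q.2 := ⟨_, fun _ _ => Iff.rfl⟩
  have hSE : S.card ≤ 2 * E.card := by
    have h1 : S ⊆ E ∪ E.image Prod.swap := by
      rintro ⟨p, q⟩ h
      simp only [hS, hE, Finset.mem_filter, Finset.mem_product, Finset.mem_union,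
        Finset.mem_image, Prod.exists, Prod.swap_prod_mk] at h ⊢
      rcases le_total (rk p.2) (rk q.2) with hpq | hpq
      · exact Or.inl ⟨h.1, h.2, hpq⟩
      · exact Or.inr ⟨_, _, _, _, ⟨h.1.symm, h.2.symm, hpq⟩, rfl⟩
    have h2 := (Finset.card_le_card h1).trans (Finset.card_union_le _ _)
    have h3 := Finset.card_image_le (s := E) (f := Prod.swap)
    omega
  have hfib : ∀ b, (M.filter fun p => blk p.2 = b).card ^ 2 ≤ S.card := by
    intro b
    rw [sq, ← Finset.card_product]
    refine Finset.card_le_card fun t ht => ?_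
    simp only [hS, Finset.mem_filter, Finset.mem_product] at ht ⊢
    exact ⟨⟨ht.1.1, ht.2.1⟩, ht.1.2.trans ht.2.2.symm⟩
  -- With this `w` the relation has exactly w²/2 pairs. A block with `b` pairs of the matching
  -- contributes b² to `S`, and |S| ≤ 2|E|, so `w` bounds the block sizes and therefore all degrees.
  set w : ℝ := √(2 * E.card) with hw
  have hw2 : w ^ 2 = 2 * E.card := Real.sq_sqrt (by positivity)
  have hfibw : ∀ b, ((M.filter fun p => blk p.2 = b).card : ℝ) ≤ w := by
    intro b
    refine Real.le_sqrt_of_sq_le ?_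
    exact_mod_cast (hfib b).trans hSE
  -- Cauchy–Schwarz over the `B` blocks.
  have hMw : (M.card : ℝ) ≤ √B * w := by
    have h1 : M.card = ∑ b ∈ Finset.range B, (M.filter fun p => blk p.2 = b).card :=
      Finset.card_eq_sum_card_fiberwise fun p hp => by simpa using hblk p hp
    have h2 : S.card = ∑ b ∈ Finset.range B, (S.filter fun t => blk t.1.2 = b).card :=
      Finset.card_eq_sum_card_fiberwise fun t ht => by
        simp only [hS, Finset.coe_filter, Finset.mem_product, Set.mem_ofPred_eq] at ht
        simpa using hblk _ ht.1.1
    have h3 : ∑ b ∈ Finset.range B, (M.filter fun p => blk p.2 = b).card ^ 2 ≤ S.card := by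
      rw [h2]
      refine Finset.sum_le_sum fun b _ => ?_
      rw [sq, ← Finset.card_product]
      refine Finset.card_le_card fun t ht => ?_
      simp only [hS, Finset.mem_filter, Finset.mem_product] at ht ⊢
      exact ⟨⟨⟨ht.1.1, ht.2.1⟩, ht.1.2.trans ht.2.2.symm⟩, ht.1.2⟩
    have h4 : M.card ^ 2 ≤ B * S.card := by
      rw [h1]
      refine sq_sum_le_card_mul_sum_sq.trans ?_
      rw [Finset.card_range]
      exact Nat.mul_le_mul_left _ h3
    refine abs_le_of_sq_le_sq' ?_ (by positivity) |>.2
    rw [mul_pow, hw2, Real.sq_sqrt (by positivity)]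
    exact_mod_cast h4.trans (Nat.mul_le_mul_left _ hSE)
  have hrow : ∀ u, ((Finset.univ.filter (r₀ u)).card : ℝ) ≤ w := by
    intro u
    rcases (Finset.univ.filter (r₀ u)).eq_empty_or_nonempty with h | ⟨v, hv⟩
    · rw [h]
      simp [hw]
    · obtain ⟨p, hp, -, -, hu, -⟩ := (hr₀ _ _).1 (Finset.mem_filter.1 hv).2
      refine le_trans ?_ (hfibw (blk p.2))
      refine Nat.cast_le.2 ((Finset.card_le_card fun v' hv' => ?_).trans
        (Finset.card_image_le (f := Prod.snd)))
      obtain ⟨p', hp', q, hq, hu', hv', hb, -⟩ := (hr₀ _ _).1 (Finset.mem_filter.1 hv').2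
      obtain rfl := hfst hp hp' (hu.symm.trans hu')
      exact Finset.mem_image.2 ⟨q, Finset.mem_filter.2 ⟨hq, hb.symm⟩, hv'.symm⟩
  have hcol : ∀ v, ((Finset.univ.filter fun u => r₀ u v).card : ℝ) ≤ w := by
    intro v
    rcases (Finset.univ.filter fun u => r₀ u v).eq_empty_or_nonempty with h | ⟨u, hu⟩
    · rw [h]
      simp [hw]
    · obtain ⟨-, -, q, hq, -, hv, -⟩ := (hr₀ _ _).1 (Finset.mem_filter.1 hu).2
      refine le_trans ?_ (hfibw (blk q.2))
      refine Nat.cast_le.2 ((Finset.card_le_card fun u' hu' => ?_).trans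
        (Finset.card_image_le (f := Prod.fst)))
      obtain ⟨p, hp, q', hq', hu', hv', hb, -⟩ := (hr₀ _ _).1 (Finset.mem_filter.1 hu').2
      obtain rfl := hsnd hq hq' (hv.symm.trans hv')
      exact Finset.mem_image.2 ⟨p, Finset.mem_filter.2 ⟨hp, hb⟩, hu'.symm⟩
  have hcard : ((Finset.univ.filter fun p : V × V => r₀ p.1 p.2).card : ℝ) = w ^ 2 / 2 := by
    rw [hw2, mul_div_cancel_left₀ _ two_ne_zero]
    refine congrArg _ (Eq.trans (congrArg _ ?_) (Finset.card_image_of_injOn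
      (s := E) (f := fun t => (t.1.1, t.2.2)) ?_))
    · ext ⟨u, v⟩
      simp only [hr₀, hE, Finset.mem_filter, Finset.mem_univ, true_and, Finset.mem_image,
        Finset.mem_product]
      constructor
      · rintro ⟨p, hp, q, hq, rfl, rfl, h⟩
        exact ⟨(p, q), ⟨⟨hp, hq⟩, h⟩, rfl⟩
      · rintro ⟨⟨p, q⟩, ⟨⟨hp, hq⟩, h⟩, heq⟩
        cases heq
        exact ⟨p, hp, q, hq, rfl, rfl, h⟩
    · rintro ⟨p, q⟩ h ⟨p', q'⟩ h' heq
      simp only [hE, Finset.coe_filter, Finset.mem_product, Set.mem_ofPred_eq] at h h'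
      simp only [Prod.mk.injEq] at heq ⊢
      exact ⟨hfst h.1.1 h'.1.1 heq.1, hsnd h.1.2 h'.1.2 heq.2⟩
  refine (card_hit_ge r₀ hrow hcol hcard ?_).trans
    (Nat.cast_le.2 (Finset.card_le_card fun ω hω => ?_))
  rotate_left
  · obtain ⟨i, j, h⟩ := (Finset.mem_filter.1 hω).2
    obtain ⟨p, hp, q, hq, hi, hj, hb, hrk⟩ := (hr₀ _ _).1 h
    refine Finset.mem_filter.2 ⟨Finset.mem_univ _, i, j, ?_⟩
    rw [hi, hj]
    exact hr p hp q hq hb hrk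
  have hBpos : 0 < √(B : ℝ) := Real.sqrt_pos.2 (by exact_mod_cast hB)
  refine le_of_mul_le_mul_right (hs.trans ?_) hBpos
  calc (s : ℝ) * M.card ≤ s * (√B * w) := mul_le_mul_of_nonneg_left hMw (by positivity)
    _ = s * w * √B := by ring

/-- The edge sets of two graphs of degree at most `d` that differ only at the vertices of `W`. -/
theorem ncard_symmDiff_edgeSet_le {n d : ℕ} {G G' : SimpleGraph (Fin n)} {W : Finset (Fin n)}
    (hG : ∀ v, (G.neighborSet v).ncard ≤ d) (hG' : ∀ v, (G'.neighborSet v).ncard ≤ d)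
    (hW : ∀ u v, ¬ (G.Adj u v ↔ G'.Adj u v) → u ∈ W ∨ v ∈ W) :
    (symmDiff G.edgeSet G'.edgeSet).ncard ≤ W.card * (2 * d) := by
  classical
  let F : Fin n → Finset (Sym2 (Fin n)) := fun w =>
    (Finset.univ.filter (G.Adj w) ∪ Finset.univ.filter (G'.Adj w)).image
      fun u => s(w, u)
  have hF : ∀ w u, (G.Adj w u ∨ G'.Adj w u) → s(w, u) ∈ F w := by
    intro w u h
    exact Finset.mem_image.2 ⟨u, by simpa using h, rfl⟩
  have hsub : symmDiff G.edgeSet G'.edgeSet ⊆ (W.biUnion F : Finset (Sym2 (Fin n))) := by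
    intro e he
    induction e with
    | _ u v =>
      simp only [Set.mem_symmDiff, SimpleGraph.mem_edgeSet] at he
      rw [Finset.mem_coe, Finset.mem_biUnion]
      rcases hW u v (by tauto) with h | h
      · exact ⟨u, h, hF u v (by tauto)⟩
      · refine ⟨v, h, ?_⟩
        rw [Sym2.eq_swap]
        refine hF v u ?_
        rw [G.adj_comm, G'.adj_comm]
        tauto
  refine (Set.ncard_le_ncard hsub (Finset.finite_toSet _)).trans ?_
  rw [Set.ncard_coe_finset]
  refine Finset.card_biUnion_le_card_mul _ _ _ fun w _ => ?_
  refine Finset.card_image_le.trans ((Finset.card_union_le _ _).trans ?_)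
  have h1 := hG w
  have h2 := hG' w
  rw [← card_filter_adj] at h1 h2
  omega

/-! ### Soundness: graphs far from the property are rejected. -/

namespace LabeledGraph

variable {n d : ℕ} {X : LabeledGraph n d}

theorem ncard_neighborSet_le (X : LabeledGraph n d) (v : Fin n) :
    (X.graph.neighborSet v).ncard ≤ d := by
  have : X.graph.neighborSet v = ((X.adjList v).toFinset : Set (Fin n)) := by
    ext u
    simp [X.mem_adjList]
  rw [this, Set.ncard_coe_finset]
  exact (List.toFinset_card_le _).trans (X.adjList_length v)

theorem ncard_neighborSet_comap (G : SimpleGraph (Fin n)) (e : Fin n ≃ Fin n) (v : Fin n) :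
    ((G.comap e).neighborSet v).ncard = (G.neighborSet (e v)).ncard := by
  rw [← Set.ncard_image_of_injective _ e.injective]
  congr 1
  ext u
  simp only [Set.mem_image, SimpleGraph.mem_neighborSet, SimpleGraph.comap_adj]
  exact ⟨by rintro ⟨x, hx, rfl⟩; exact hx, fun h => ⟨e.symm u, by simpa using h, by simp⟩⟩

/-- A set that hits all violations of a graph that is far from the property is large. -/
theorem IsFar.lt_card {ε : ℝ} (hX : X.IsFar ε) {Z : Finset (Fin n)}
    (hZ : ∀ a b c, Violates X.labelGraph a b c → a ∈ Z ∨ b ∈ Z ∨ c ∈ Z) :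
    ε * n < 10 * d * (d + 1) * Z.card := by
  obtain ⟨L', W, hdeg, hviol, hcard, hdiff⟩ := exists_repair (d := d)
    (fun v => (ncard_neighborSet_comap X.graph X.num.symm v).trans_le
      (X.ncard_neighborSet_le _)) hZ
  have hcomap : (L'.comap X.num).comap X.num.symm = L' := by
    ext u v
    simp
  have hdeg' : ∀ v, ((L'.comap X.num).neighborSet v).ncard ≤ d := fun v =>
    (ncard_neighborSet_comap L' X.num v).trans_le (hdeg _)
  have h1 := hX (L'.comap X.num) hdeg' (by rw [isDFSNumbering_iff, hcomap]; exact hviol)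
  have h2 := ncard_symmDiff_edgeSet_le (W := W.map X.num.symm.toEmbedding) X.ncard_neighborSet_le
    hdeg' fun u v h => by
      have := hdiff (X.num u) (X.num v) (by simpa using h)
      simpa using this
  rw [Finset.card_map] at h2
  have h3 : W.card * (2 * d) ≤ 5 * (d + 1) * Z.card * (2 * d) := Nat.mul_le_mul_right _ hcard
  refine h1.trans_le ((Nat.cast_le.2 (h2.trans h3)).trans_eq ?_)
  push_cast
  ring

theorem IsFar.exists_violates {ε : ℝ} (hX : X.IsFar ε) (hε : 0 ≤ ε) :
    ∃ a b c, Violates X.labelGraph a b c := by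
  by_contra h
  push Not at h
  have := hX.lt_card (Z := ∅) fun a b c habc => absurd habc (h a b c)
  simp only [Finset.card_empty, Nat.cast_zero, mul_zero] at this
  exact absurd this (not_lt.2 (by positivity))

theorem fuel_le_add {k i j : ℕ} (hk : 0 < k) (h : i / k = j / k) : i ≤ j + k := by
  have h1 := Nat.div_add_mod i k
  have h2 := Nat.div_add_mod j k
  have h3 := Nat.mod_lt i hk
  rw [h] at h1
  omega

/-- Violations in the same block can be combined. -/
theorem violates_of_block_eq {k : ℕ} (hk : 0 < k) {a x c a' x' c' : Fin n}
    (h : Violates X.labelGraph a x c) (hc : X.Passes k (X.num.symm c))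
    (h' : Violates X.labelGraph a' x' c') (hx' : X.Passes k (X.num.symm x')) (hle : x ≤ x')
    (hb : X.fuel (X.num.symm x) / k = X.fuel (X.num.symm x') / k) :
    Violates X.labelGraph a x' c := by
  have hf : X.fuel (X.num.symm x') ≤ X.fuel (X.num.symm x) + k := fuel_le_add hk hb.symm
  have hmono : ∀ {i j : Fin n}, i ≤ j → X.fuel (X.num.symm i) ≤ X.fuel (X.num.symm j) :=
    fun hij => fuel_mono (by simpa using hij)
  -- If `c ≤ x'`, then the walk from `c` reaches `x`. If `x'` has a neighbor `e` with `a ≤ e < x <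
  -- x'`, then the edge `e x'` jumps over `x`, within reach of the walk from `x'`. If `x ≤ e < x'`,
  -- then `e < a'`, and the same walk reaches `a'`. Each case contradicts a passed walk.
  refine ⟨h.1.trans_le hle, ?_, h.2.2.1, fun e he hex' => ?_⟩
  · by_contra hcx
    exact not_violates_of_passes_upper hc ((hmono (not_lt.1 hcx)).trans hf) h
  · by_contra hae
    rcases lt_or_ge e x with hex | hex
    · rcases hle.eq_or_lt with rfl | hlt
      · exact hae (h.2.2.2 e he hex)
      · exact not_violates_of_passes_upper hx' hf
          ⟨hex, hlt, he, fun f hf hfx => (h.2.2.2 f hf hfx).trans_le (not_lt.1 hae)⟩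
    · have hea' := h'.2.2.2 e he hex'
      exact not_violates_of_passes_middle hx'
        (hf.trans (Nat.add_le_add_right (hmono (hex.trans hea'.le)) k)) he hea' h'

/-- The test succeeds for the starting vertices `ω.1` and the two samples in `ω.2`. -/
def Accepts (X : LabeledGraph n d) (k : ℕ) {s₁ s : ℕ}
    (ω : (Fin s₁ → Fin n) × (Fin s → Fin n) × (Fin s → Fin n)) : Prop :=
  (∀ i, X.Passes k (ω.1 i)) ∧ X.Consistent (List.ofFn ω.2.1 ++ List.ofFn ω.2.2)

open Classical in
theorem queryable_accepts (k : ℕ) {s₁ s : ℕ}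
    (ω : (Fin s₁ → Fin n) × (Fin s → Fin n) × (Fin s → Fin n)) :
    Queryable (s₁ * (k * stepCost d + (k + 1) * (2 * d + 1)) + (s + s) * (2 * d + 1))
      fun X : LabeledGraph n d => decide (X.Accepts k ω) := by
  have h1 := Queryable.listMap (List.ofFn ω.1) fun v _ => queryable_passes (d := d) k v
  have h2 := queryable_consistent (d := d) (List.ofFn ω.2.1 ++ List.ofFn ω.2.2)
  rw [List.length_ofFn] at h1
  rw [List.length_append, List.length_ofFn, List.length_ofFn] at h2
  convert (h1.prod h2).map fun p => p.1.all id && p.2 using 2 with X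
  rw [Bool.eq_iff_iff, decide_eq_true_iff]
  simp [Accepts]

open Classical in
/-- Many vertices that fail the test are found by sampling. -/
theorem card_not_accepts_of_not_passes [Nonempty (Fin n)] {k s₁ s : ℕ} {δ : ℝ} (hδ : δ ≤ 1)
    (hP : δ * n ≤ ((Finset.univ.filter fun v => ¬ X.Passes k v).card : ℝ)) (hs : 2 ≤ δ * s₁) :
    2 / 3 * (Fintype.card ((Fin s₁ → Fin n) × (Fin s → Fin n) × (Fin s → Fin n)) : ℝ) ≤
      (Finset.univ.filter fun ω : (Fin s₁ → Fin n) × (Fin s → Fin n) × (Fin s → Fin n) =>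
        ¬ X.Accepts k ω).card := by
  set Ω := (Fin s₁ → Fin n) × (Fin s → Fin n) × (Fin s → Fin n)
  set P := Finset.univ.filter fun v => X.Passes k v
  have hn : 0 < n := by
    obtain ⟨v⟩ := ‹Nonempty (Fin n)›
    exact v.pos
  have hsub : (Finset.univ.filter fun ω : Ω => X.Accepts k ω) ⊆
      Fintype.piFinset (fun _ : Fin s₁ => P) ×ˢ Finset.univ := by
    intro ω hω
    exact Finset.mem_product.2 ⟨Fintype.mem_piFinset.2 fun i => Finset.mem_filter.2
      ⟨Finset.mem_univ _, (Finset.mem_filter.1 hω).2.1 i⟩, Finset.mem_univ _⟩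
  have hcard := Finset.card_le_card hsub
  rw [Finset.card_product, Fintype.card_piFinset_const, Finset.card_univ] at hcard
  have hP' : (P.card : ℝ) ≤ (1 - δ) * n := by
    have := Finset.card_filter_add_card_filter_not (s := (Finset.univ : Finset (Fin n)))
      (fun v => X.Passes k v)
    rw [Finset.card_univ, Fintype.card_fin] at this
    have h : (P.card : ℝ) + ((Finset.univ.filter fun v => ¬ X.Passes k v).card : ℝ) = n := by
      exact_mod_cast this
    linarith
  -- Bounded by exp(-2), and exp 2 ≥ 3.
  have hpow : (1 - δ) ^ s₁ ≤ 1 / 3 := by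
    have h1 : (1 - δ) ^ s₁ ≤ Real.exp (-δ) ^ s₁ :=
      pow_le_pow_left₀ (by linarith) (by linarith [Real.add_one_le_exp (-δ)]) _
    rw [← Real.exp_nat_mul] at h1
    refine h1.trans ((Real.exp_le_exp.2 (show (s₁ : ℝ) * -δ ≤ -2 by linarith)).trans ?_)
    rw [Real.exp_neg, one_div]
    refine inv_anti₀ (by norm_num) ?_
    linarith [Real.add_one_le_exp 2]
  have hsum := Finset.card_filter_add_card_filter_not (s := (Finset.univ : Finset Ω))
    (fun ω => X.Accepts k ω)
  rw [Finset.card_univ] at hsum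
  have hsum' : ((Finset.univ.filter fun ω : Ω => X.Accepts k ω).card : ℝ) +
      (Finset.univ.filter fun ω : Ω => ¬ X.Accepts k ω).card = Fintype.card Ω := by
    exact_mod_cast hsum
  have hΩ : (Fintype.card Ω : ℝ) =
      (n : ℝ) ^ s₁ * Fintype.card ((Fin s → Fin n) × (Fin s → Fin n)) := by
    simp [Ω]
  have hacc : ((Finset.univ.filter fun ω : Ω => X.Accepts k ω).card : ℝ) ≤
      1 / 3 * Fintype.card Ω := by
    calc ((Finset.univ.filter fun ω : Ω => X.Accepts k ω).card : ℝ)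
        ≤ (P.card : ℝ) ^ s₁ * Fintype.card ((Fin s → Fin n) × (Fin s → Fin n)) := by
          exact_mod_cast hcard
      _ ≤ ((1 - δ) * n) ^ s₁ * Fintype.card ((Fin s → Fin n) × (Fin s → Fin n)) := by gcongr
      _ = (1 - δ) ^ s₁ * Fintype.card Ω := by rw [mul_pow, hΩ, mul_assoc]
      _ ≤ 1 / 3 * Fintype.card Ω := by gcongr
  linarith

open Classical in
/-- If few vertices fail the test, then the samples reveal a violation. -/
theorem card_not_accepts_of_passes [Nonempty (Fin n)] {k s₁ s B : ℕ} (hk : 0 < k)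
    (hB : 2 * n / k < B) {m : ℝ} (hs : 20 * n * √B ≤ s * m)
    (hm : ∀ Z : Finset (Fin n), (∀ a b c, Violates X.labelGraph a b c → a ∈ Z ∨ b ∈ Z ∨ c ∈ Z) →
      (Finset.univ.filter fun v => ¬ X.Passes k v).card + 2 * m ≤ Z.card) :
    2 / 3 * (Fintype.card ((Fin s₁ → Fin n) × (Fin s → Fin n) × (Fin s → Fin n)) : ℝ) ≤
      (Finset.univ.filter fun ω : (Fin s₁ → Fin n) × (Fin s → Fin n) × (Fin s → Fin n) =>
        ¬ X.Accepts k ω).card := by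
  obtain ⟨M, hM, hfst, hsnd, hmax⟩ := exists_maximal_matching fun a x : Fin n => X.Passes k x ∧
    ∃ c, X.Passes k c ∧ Violates X.labelGraph (X.num a) (X.num x) (X.num c)
  set bad := Finset.univ.filter fun v => ¬ X.Passes k v with hbad
  -- By maximality the failing vertices and both sides of the matching hit all violations.
  have hmM : m ≤ M.card := by
    have h1 := hm ((bad ∪ (M.image Prod.fst ∪ M.image Prod.snd)).image X.num) ?_
    · have h2 : ((bad ∪ (M.image Prod.fst ∪ M.image Prod.snd)).image X.num).card ≤
          bad.card + (M.card + M.card) :=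
        Finset.card_image_le.trans ((Finset.card_union_le _ _).trans (Nat.add_le_add_left
          ((Finset.card_union_le _ _).trans
            (Nat.add_le_add Finset.card_image_le Finset.card_image_le)) _))
      have h3 := h1.trans (Nat.cast_le.2 h2)
      push_cast at h3
      linarith
    · intro a b c h
      have hmem : ∀ u, X.num.symm u ∈ bad ∪ (M.image Prod.fst ∪ M.image Prod.snd) →
          u ∈ (bad ∪ (M.image Prod.fst ∪ M.image Prod.snd)).image X.num :=
        fun u hu => Finset.mem_image.2 ⟨_, hu, X.num.apply_symm_apply u⟩
      by_cases hb : X.Passes k (X.num.symm b)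
      · by_cases hc : X.Passes k (X.num.symm c)
        · rcases hmax (X.num.symm a) (X.num.symm b) ⟨hb, X.num.symm c, hc, by simpa using h⟩ with
            ⟨p, hp, hpa⟩ | ⟨p, hp, hpb⟩
          · exact Or.inl (hmem a (Finset.mem_union_right _ (Finset.mem_union_left _
              (Finset.mem_image.2 ⟨p, hp, hpa⟩))))
          · exact Or.inr (Or.inl (hmem b (Finset.mem_union_right _ (Finset.mem_union_right _
              (Finset.mem_image.2 ⟨p, hp, hpb⟩)))))
        · exact Or.inr (Or.inr (hmem c (Finset.mem_union_left _ (by simp [hbad, hc]))))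
      · exact Or.inr (Or.inl (hmem b (Finset.mem_union_left _ (by simp [hbad, hb]))))
  have hhit := card_hit_matching_ge (s := s) M hfst hsnd (fun v => X.fuel v / k)
    (fun v => (X.num v).val) (hB.pos) (fun p _ => (Nat.div_le_div_right (X.fuel_le _)).trans_lt hB)
    (by
      rw [Fintype.card_fin]
      exact hs.trans (mul_le_mul_of_nonneg_left hmM (by positivity)))
    (r := fun u v => X.SeesViolation u v) fun p hp q hq hb hle => by
      obtain ⟨-, c, hc, hv⟩ := hM p hp
      obtain ⟨hx', c', -, hv'⟩ := hM q hq
      have := seesViolation_left (violates_of_block_eq hk hv (by simpa using hc) hv'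
        (by simpa using hx') hle (by simpa using hb))
      simpa using this
  have hsub : (Finset.univ : Finset (Fin s₁ → Fin n)) ×ˢ
      (Finset.univ.filter fun ω : (Fin s → Fin n) × (Fin s → Fin n) =>
        ∃ i j, X.SeesViolation (ω.1 i) (ω.2 j)) ⊆
      Finset.univ.filter fun ω : (Fin s₁ → Fin n) × (Fin s → Fin n) × (Fin s → Fin n) =>
        ¬ X.Accepts k ω := by
    intro ω hω
    simp only [Finset.mem_product, Finset.mem_filter, Finset.mem_univ, true_and] at hω ⊢
    obtain ⟨i, j, h⟩ := hω
    exact fun hacc => hacc.2 _ (by simp [List.mem_ofFn]) _ (by simp [List.mem_ofFn]) h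
  have hcard := Finset.card_le_card hsub
  rw [Finset.card_product, Finset.card_univ] at hcard
  refine le_trans ?_ (Nat.cast_le.2 hcard)
  rw [Fintype.card_prod, Nat.cast_mul, Nat.cast_mul]
  calc _ = (Fintype.card (Fin s₁ → Fin n) : ℝ) *
        (2 / 3 * (Fintype.card ((Fin s → Fin n) × (Fin s → Fin n)) : ℝ)) := by ring
    _ ≤ _ := mul_le_mul_of_nonneg_left hhit (by positivity)

open Classical in
theorem IsFar.card_not_accepts_ge {ε : ℝ} (hε : 0 < ε) (hε1 : ε < 1) (hn : 0 < n) {D : ℝ}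
    (hD : 10 * d * (d + 1) + 1 ≤ D) {k s₁ s : ℕ} (hk : (n : ℝ) ^ (1 / 3 : ℝ) ≤ k)
    (hs₁ : 4 * D / ε ≤ s₁) (hs : 160 * D * (n : ℝ) ^ (1 / 3 : ℝ) / ε ≤ s) (hX : X.IsFar ε) :
    2 / 3 * (Fintype.card ((Fin s₁ → Fin n) × (Fin s → Fin n) × (Fin s → Fin n)) : ℝ) ≤
      (Finset.univ.filter fun ω : (Fin s₁ → Fin n) × (Fin s → Fin n) × (Fin s → Fin n) =>
        ¬ X.Accepts k ω).card := by
  have : Nonempty (Fin n) := ⟨⟨0, hn⟩⟩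
  have hD1 : 1 ≤ D := le_trans (by have : (0 : ℝ) ≤ 10 * d * (d + 1) := by positivity
                                   linarith) hD
  have hD0 : 0 < D := by linarith
  have hnR : (1 : ℝ) ≤ n := by exact_mod_cast hn
  set t : ℝ := (n : ℝ) ^ (1 / 3 : ℝ) with ht
  have ht1 : 1 ≤ t := Real.one_le_rpow hnR (by norm_num)
  have ht3 : t ^ 3 = n := by
    rw [ht, ← Real.rpow_natCast, ← Real.rpow_mul (by positivity)]
    norm_num
  -- Every hitting set has at least εn/D vertices. Half of this is the threshold for failing
  -- vertices, the other half is left for the two sides of the matching, which gives `m = εn/(4D)`.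
  rcases le_or_gt (ε / (2 * D) * n)
    ((Finset.univ.filter fun v => ¬ X.Passes k v).card : ℝ) with hbad | hbad
  · refine card_not_accepts_of_not_passes ?_ hbad ?_
    · rw [div_le_one (by positivity)]
      linarith
    · calc (2 : ℝ) = ε / (2 * D) * (4 * D / ε) := by field_simp; norm_num
        _ ≤ _ := mul_le_mul_of_nonneg_left hs₁ (by positivity)
  · have hk0 : 0 < k := by
      have : (0 : ℝ) < k := by linarith
      exact_mod_cast this
    refine card_not_accepts_of_passes (B := 2 * n / k + 1) (m := ε * n / (4 * D)) hk0
      (Nat.lt_succ_self _) ?_ fun Z hZ => ?_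
    -- With `k ≥ t` and `t³ = n` there are at most 2t² + 1 ≤ 4t² blocks.
    · have hB : √((2 * n / k + 1 : ℕ) : ℝ) ≤ 2 * t := by
        refine Real.sqrt_le_iff.2 ⟨by positivity, ?_⟩
        have h1 : ((2 * n / k : ℕ) : ℝ) ≤ 2 * t ^ 2 := by
          refine Nat.cast_div_le.trans ?_
          rw [div_le_iff₀ (by exact_mod_cast hk0)]
          push_cast
          calc 2 * (n : ℝ) = 2 * t ^ 2 * t := by rw [← ht3]; ring
            _ ≤ _ := mul_le_mul_of_nonneg_left hk (by positivity)
        push_cast at h1 ⊢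
        nlinarith
      calc 20 * n * √((2 * n / k + 1 : ℕ) : ℝ) ≤ 20 * n * (2 * t) := by gcongr
        _ = 160 * D * t / ε * (ε * n / (4 * D)) := by field_simp; norm_num
        _ ≤ _ := mul_le_mul_of_nonneg_right hs (by positivity)
    · have h1 := hX.lt_card hZ
      have h2 : ε * n ≤ D * Z.card :=
        h1.le.trans (mul_le_mul_of_nonneg_right (by linarith) (by positivity))
      have h3 : ε / (2 * D) * n + 2 * (ε * n / (4 * D)) = ε * n / D := by
        field_simp
        norm_num
      have h4 : ε * n / D ≤ Z.card := by
        rw [div_le_iff₀ hD0]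
        linarith
      linarith

end LabeledGraph

/-! ### The tester and the final constants. -/

open LabeledGraph

theorem exists_tester (n d : ℕ) {ε : ℝ} (hε : 0 < ε) (hε1 : ε < 1) :
    ∃ T : RandomizedTester n d, ∀ X : LabeledGraph n d,
      (∀ A ∈ T.support, (A.queries X : ℝ) ≤
        ((5 * (2 * stepCost d + 3 * (2 * d + 1)) + 322 * (2 * d + 1)) * (10 * d * (d + 1) + 1) : ℕ) *
          ((n : ℝ) ^ (1 / 3 : ℝ) / ε)) ∧
      (IsDFSNumbering X.graph X.num → ∀ A ∈ T.support, A.run X = true) ∧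
      (X.IsFar ε → 2 / 3 ≤ RandomizedTester.rejectProb T X) := by
  classical
  -- Without vertices there is nothing to sample, and no violation, so no input is far.
  rcases Nat.eq_zero_or_pos n with rfl | hn
  · refine ⟨PMF.pure (.halt true), fun X => ⟨fun A hA => ?_, fun _ A hA => ?_, fun hX => ?_⟩⟩
    · rw [PMF.support_pure, Set.mem_singleton_iff] at hA
      subst hA
      simp only [QueryAlgorithm.queries, Nat.cast_zero]
      positivity
    · rw [PMF.support_pure, Set.mem_singleton_iff] at hA
      subst hA
      rfl
    · obtain ⟨a, -⟩ := hX.exists_violates hε.le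
      exact a.elim0
  have : Nonempty (Fin n) := ⟨⟨0, hn⟩⟩
  -- The summand 1 keeps `D` positive for `d = 0`.
  obtain ⟨D, hD⟩ : ∃ D : ℕ, D = 10 * d * (d + 1) + 1 := ⟨_, rfl⟩
  have hD' : (10 * d * (d + 1) + 1 : ℝ) ≤ D := by rw [hD]; push_cast; rfl
  have hD1 : (1 : ℝ) ≤ D := by
    rw [hD]
    exact_mod_cast Nat.le_add_left _ _
  have hnR : (1 : ℝ) ≤ n := by exact_mod_cast hn
  set t : ℝ := (n : ℝ) ^ (1 / 3 : ℝ) with ht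
  have ht1 : 1 ≤ t := Real.one_le_rpow hnR (by norm_num)
  let k := ⌈t⌉₊
  let s₁ := ⌈4 * D / ε⌉₊
  let s := ⌈160 * D * t / ε⌉₊
  choose A hA using fun ω : (Fin s₁ → Fin n) × (Fin s → Fin n) × (Fin s → Fin n) =>
    (queryable_accepts (d := d) k ω).exists_algorithm
  refine ⟨(PMF.uniformOfFintype _).map A, fun X => ⟨fun _ h => ?_, fun hX _ h => ?_, fun hX => ?_⟩⟩
  · obtain ⟨ω, -, rfl⟩ := (PMF.mem_support_map_iff _ _ _).1 h
    refine (Nat.cast_le.2 (hA ω X).2).trans ?_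
    have hk : (k : ℝ) ≤ 2 * t := by linarith [Nat.ceil_lt_add_one (show 0 ≤ t by linarith)]
    have hε' : 1 ≤ 1 / ε := by
      rw [le_div_iff₀ hε]
      linarith
    have hDε : 1 ≤ D / ε := by
      rw [le_div_iff₀ hε]
      linarith
    have hDtε : 1 ≤ D * t / ε := by
      rw [le_div_iff₀ hε]
      nlinarith
    have hs₁ : (s₁ : ℝ) ≤ 5 * (D / ε) := by
      have := Nat.ceil_lt_add_one (show 0 ≤ 4 * (D : ℝ) / ε by positivity)
      have h2 : 4 * (D : ℝ) / ε = 4 * (D / ε) := by ring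
      linarith
    have hs : (s : ℝ) ≤ 161 * (D * t / ε) := by
      have := Nat.ceil_lt_add_one (show 0 ≤ 160 * (D : ℝ) * t / ε by positivity)
      have h2 : 160 * (D : ℝ) * t / ε = 160 * (D * t / ε) := by ring
      linarith
    rw [← hD]
    push_cast
    calc (s₁ : ℝ) * (k * stepCost d + (k + 1) * (2 * d + 1)) + (s + s) * (2 * d + 1)
        ≤ 5 * (D / ε) * (2 * t * stepCost d + (3 * t) * (2 * d + 1)) +
          (161 * (D * t / ε) + 161 * (D * t / ε)) * (2 * d + 1) := by
          gcongr
          linarith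
      _ = _ := by ring
  · obtain ⟨ω, -, rfl⟩ := (PMF.mem_support_map_iff _ _ _).1 h
    rw [(hA ω X).1, decide_eq_true_iff]
    have hX' := (isDFSNumbering_iff _ _).1 hX
    exact ⟨fun i => passes_of_forall_not_violates hX' k _,
      consistent_of_forall_not_violates hX' _⟩
  · have hfar := hX.card_not_accepts_ge (s₁ := s₁) (s := s) (k := k) hε hε1 hn hD'
      (Nat.le_ceil _) (Nat.le_ceil _) (Nat.le_ceil _)
    rw [RandomizedTester.rejectProb, PMF.toOuterMeasure_map_apply,
      PMF.toOuterMeasure_uniformOfFintype_apply]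
    have hset : Fintype.card (A ⁻¹' {A | A.run X = false}) =
        (Finset.univ.filter fun ω : (Fin s₁ → Fin n) × (Fin s → Fin n) × (Fin s → Fin n) =>
          ¬ X.Accepts k ω).card := by
      rw [Fintype.card_subtype]
      congr 1
      ext ω
      simp [(hA ω X).1]
    rw [hset, ENNReal.le_div_iff_mul_le (Or.inl (Nat.cast_ne_zero.2 Fintype.card_ne_zero)) (Or.inl (ENNReal.natCast_ne_top _))]
    have h1 := ENNReal.ofReal_le_ofReal hfar
    rw [ENNReal.ofReal_mul (by norm_num), ENNReal.ofReal_natCast, ENNReal.ofReal_natCast,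
      ENNReal.ofReal_div_of_pos (by norm_num), ENNReal.ofReal_ofNat, ENNReal.ofReal_ofNat] at h1
    exact h1

theorem mainTheorem1 :
    ∃ (C : ℕ → ℝ) (T : (n d : ℕ) → ℝ → RandomizedTester n d),
      ∀ (n d : ℕ) (ε : ℝ), 0 < ε → ε < 1 → ∀ X : LabeledGraph n d,
        (∀ A ∈ (T n d ε).support, (A.queries X : ℝ) ≤ C d * ((n : ℝ) ^ (1 / 3 : ℝ) / ε)) ∧
        (IsDFSNumbering X.graph X.num → ∀ A ∈ (T n d ε).support, A.run X = true) ∧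
        (X.IsFar ε → 2 / 3 ≤ RandomizedTester.rejectProb (T n d ε) X) := by
  have h : ∀ (n d : ℕ) (ε : ℝ), ∃ T : RandomizedTester n d, 0 < ε → ε < 1 →
      ∀ X : LabeledGraph n d, _ := fun n d ε => by
    by_cases hε : 0 < ε ∧ ε < 1
    · obtain ⟨T, hT⟩ := exists_tester n d hε.1 hε.2
      exact ⟨T, fun _ _ => hT⟩
    · exact ⟨PMF.pure (.halt true), fun h1 h2 => absurd ⟨h1, h2⟩ hε⟩
  choose T hT using h
  exact ⟨fun d => ((5 * (2 * stepCost d + 3 * (2 * d + 1)) + 322 * (2 * d + 1)) *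
    (10 * d * (d + 1) + 1) : ℕ), T, hT⟩
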